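/- Let $n\ge 0$ and let $k=(k_0,\dots,k_n)$ be a string of non-negative integers. Call a string of integers $a=(a_0,\dots,a_n)$ admissible, written $a\ge 0$, if $\sum_{i=0}^n(-1)^i a_i=0$ and $a_i-a_{i-1}+a_{i-2}\mp\cdots+(-1)^i a_0\ge 0$ for all $0\le i\le n-1$; for strings of non-negative integers $k,b$ write $k\ge b$ if $k-b$ is admissible. Let $\mathbb D(k)\subseteq\bigoplus_{i=0}^{n-1}L(\mathbb C^{k_i},\mathbb C^{k_{i+1}})$ be the set of tuples $(d^0,\dots,d^{n-1})$ of linear maps with $d^{i+1}d^i=0$, that is, of cochain complexes $0\to\mathbb C^{k_0}\to\mathbb C^{k_1}\to\cdots\to\mathbb C^{k_n}\to 0$. Let $\mathbb D_{\rm ac}(k)\subseteq\mathbb D(k)$ be the subset of acyclic complexes and, for $b=(b_0,\dots,b_n)$ a string of non-negative integers, let $\mathbb D_b(k)\subseteq\mathbb D(k)$ be the subset of complexes $C$ with $\dim H^i(C)=b_i$ for all $i$. Let $\hat{\mathbb D}_{\rm ac}(k)$ and $\hat{\mathbb D}_b(k)$ denote their closures in $\bigoplus_i L(\mathbb C^{k_i},\mathbb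 C^{k_{i+1}})$. 1. If $k\ge 0$, then $\mathbb D_{\rm ac}(k)$ is a (non-empty) connected smooth quasi-affine algebraic set, and if $k\ge b$, then $\mathbb D_b(k)$ is a (non-empty) connected smooth quasi-affine algebraic set; connectedness holds in the Zariski and in the Euclidean topology. The dimension is $$\dim\mathbb D_b(k)=\sum_{j=0}^n(k_j-b_j)\Bigl(k_j-\sum_{i\le j}(-1)^{i+j}(k_i-b_i)\Bigr),$$ and $\dim\mathbb D_{\rm ac}(k)$ is given by the same formula with $b=0$. 2. If $k\ge 0$, respectively $k\ge b$, then the Zariski closure $\hat{\mathbb D}_{\rm ac}(k)$, respectively $\hat{\mathbb D}_b(k)$, is an irreducible algebraic set, hence an affine algebraic variety. For every $b$ the Zariski closure $\hat{\mathbb D}_b(k)$ coincides with the closure in the Euclidean topology, and it is the disjoint union $$\hat{\mathbb D}_b(k)=\bigsqcup_{k\ge b'\ge b}\mathbb D_{b'}(k),$$ where $b'$ runs over the strings of non-negative integers with $k\ge b'$ and $b'\ge b$. -/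

import Mathlib

/-! ### Affine algebraic geometry over the complex numbers, in classical language -/

/-- The Zariski topology on the affine space `ℂ^σ`: the closed sets are the common zero loci of
(ideals of) polynomials. -/
abbrev zariski (σ : Type) : TopologicalSpace (σ → ℂ) :=
  TopologicalSpace.ofClosed
    {Z | ∃ I : Ideal (MvPolynomial σ ℂ), Z = MvPolynomial.zeroLocus ℂ I}
    ⟨⊤, by simp⟩
    (by
      intro A hA
      refine ⟨MvPolynomial.vanishingIdeal ℂ (⋂₀ A), ?_⟩
      refine Set.Subset.antisymm (MvPolynomial.zeroLocus_vanishingIdeal_le _) ?_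
      intro x hx Z hZ
      obtain ⟨I, rfl⟩ := hA hZ
      intro p hp
      exact hx p fun y hy => hy _ hZ p hp)
    (by
      rintro Z ⟨I, rfl⟩ W ⟨J, rfl⟩
      refine ⟨I * J, Set.Subset.antisymm ?_ ?_⟩
      · exact Set.union_subset
          (MvPolynomial.zeroLocus_anti_mono (Ideal.mul_le_inf.trans inf_le_left))
          (MvPolynomial.zeroLocus_anti_mono (Ideal.mul_le_inf.trans inf_le_right))
      · intro x hx
        by_contra hcon
        simp only [Set.mem_union, MvPolynomial.mem_zeroLocus_iff, not_or, not_forall] at hcon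
        obtain ⟨⟨p, hp, hpx⟩, ⟨q, hq, hqx⟩⟩ := hcon
        have h := hx (p * q) (Ideal.mul_mem_mul hp hq)
        rw [map_mul] at h
        exact (mul_ne_zero hpx hqx) h)

/-- The Zariski closure of a subset of affine space. -/
def zariskiClosure {σ : Type} (S : Set (σ → ℂ)) : Set (σ → ℂ) :=
  @closure _ (zariski σ) S

/-- A quasi-affine algebraic set: a Zariski open subset of a Zariski closed subset of affine
space. -/
def IsQuasiAffine {σ : Type} (S : Set (σ → ℂ)) : Prop :=
  @IsLocallyClosed _ (zariski σ) S

/-- Connected (and non-empty) in the Zariski topology. -/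
def IsZariskiConnected {σ : Type} (S : Set (σ → ℂ)) : Prop :=
  @IsConnected _ (zariski σ) S

/-- An affine algebraic variety: a Zariski closed and irreducible (in particular non-empty)
subset of affine space. -/
def IsAffineVariety {σ : Type} (S : Set (σ → ℂ)) : Prop :=
  @IsClosed _ (zariski σ) S ∧ @IsIrreducible _ (zariski σ) S

/-- The dimension of a subset of affine space: the Krull dimension of its Zariski topology. -/
noncomputable def zariskiDim {σ : Type} (S : Set (σ → ℂ)) : WithBot ℕ∞ :=
  @topologicalKrullDim S ((zariski σ).induced Subtype.val)

/-- The local dimension of `S` at `x`: the least dimension of a Zariski open neighbourhood of `x`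
in `S`. -/
noncomputable def zariskiLocalDim {σ : Type} (S : Set (σ → ℂ)) (x : σ → ℂ) : WithBot ℕ∞ :=
  ⨅ U : {U : Set (σ → ℂ) // @IsOpen _ (zariski σ) U ∧ x ∈ U}, zariskiDim (S ∩ U)

/-- The Zariski tangent space of `S` at `x`: the common kernel of the differentials at `x` of all
polynomials vanishing on `S`. -/
noncomputable def zariskiTangentSpace {σ : Type} [Fintype σ] (S : Set (σ → ℂ)) (x : σ → ℂ) :
    Submodule ℂ (σ → ℂ) where
  carrier := {v | ∀ f ∈ MvPolynomial.vanishingIdeal ℂ S,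
    ∑ s, MvPolynomial.eval x (MvPolynomial.pderiv s f) * v s = 0}
  zero_mem' := by intro f _; simp
  add_mem' := by
    intro v w hv hw f hf
    simp only [Pi.add_apply, mul_add, Finset.sum_add_distrib, hv f hf, hw f hf, add_zero]
  smul_mem' := by
    intro c v hv f hf
    simp only [Pi.smul_apply, smul_eq_mul, mul_left_comm _ c, ← Finset.mul_sum, hv f hf, mul_zero]

/-- A smooth (nonsingular) quasi-affine algebraic set: at every point the dimension of the Zariski
tangent space equals the local dimension. -/
def IsSmoothQuasiAffine {σ : Type} [Fintype σ] (S : Set (σ → ℂ)) : Prop :=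
  IsQuasiAffine S ∧
    ∀ x ∈ S, ((Module.finrank ℂ (zariskiTangentSpace S x) : ℕ) : WithBot ℕ∞) = zariskiLocalDim S x

/-! ### Admissible strings -/

/-- `a_j - a_{j-1} + a_{j-2} ∓ ⋯ + (-1)^j a_0`. -/
def altSum {n : ℕ} (a : Fin (n + 1) → ℤ) (j : Fin (n + 1)) : ℤ :=
  ∑ i ∈ Finset.Iic j, (-1) ^ ((i : ℕ) + (j : ℕ)) * a i

/-- A string of integers is admissible if its total alternating sum vanishes and its partial
alternating sums of index at most `n - 1` are non-negative. -/
def Admissible {n : ℕ} (a : Fin (n + 1) → ℤ) : Prop :=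
  ∑ i : Fin (n + 1), (-1) ^ (i : ℕ) * a i = 0 ∧ ∀ i : Fin n, 0 ≤ altSum a i.castSucc

/-- The relation `k ≥ b` between strings: the difference `k - b` is admissible. -/
def Dominates {n : ℕ} (k b : Fin (n + 1) → ℕ) : Prop :=
  Admissible fun i => (k i : ℤ) - (b i : ℤ)

/-! ### Cochain complexes on `ℂ^{k_0}, …, ℂ^{k_n}` -/

namespace CochainStrings

variable {n : ℕ} {k : Fin (n + 1) → ℕ}

/-- The index set of the matrix entries of `(d^0, …, d^{n-1})`, `d^i : ℂ^{k_i} → ℂ^{k_{i+1}}`. -/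
abbrev Coord (k : Fin (n + 1) → ℕ) : Type :=
  Σ i : Fin n, Fin (k i.succ) × Fin (k i.castSucc)

/-- The affine space `⨁ L(ℂ^{k_i}, ℂ^{k_{i+1}})`, in terms of matrix entries. -/
abbrev Ambient (k : Fin (n + 1) → ℕ) : Type := Coord k → ℂ

/-- The linear map `d^i` of a point of the affine space. -/
noncomputable def diff (x : Ambient k) (i : Fin n) :
    (Fin (k i.castSucc) → ℂ) →ₗ[ℂ] (Fin (k i.succ) → ℂ) :=
  Matrix.toLin' (Matrix.of fun a b => x ⟨i, (a, b)⟩)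

/-- `Z^i = ker d^i`, where `d^n = 0`. -/
noncomputable def cocycles (x : Ambient k) (i : Fin (n + 1)) : Submodule ℂ (Fin (k i) → ℂ) :=
  Fin.lastCases (motive := fun i => Submodule ℂ (Fin (k i) → ℂ)) ⊤
    (fun j => LinearMap.ker (diff x j)) i

/-- `B^i = im d^{i-1}`, where `d^{-1} = 0`. -/
noncomputable def coboundaries (x : Ambient k) (i : Fin (n + 1)) :
    Submodule ℂ (Fin (k i) → ℂ) :=
  Fin.cases (motive := fun i => Submodule ℂ (Fin (k i) → ℂ)) ⊥
    (fun j => LinearMap.range (diff x j)) i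

/-- The cohomology `H^i = Z^i / B^i` (for a complex `B^i ≤ Z^i`). -/
abbrev cohomology (x : Ambient k) (i : Fin (n + 1)) : Type :=
  cocycles x i ⧸ (coboundaries x i).submoduleOf (cocycles x i)

/-- `𝔻(k)`: the tuples with `d^{i+1} ∘ d^i = 0`. -/
def complexes (k : Fin (n + 1) → ℕ) : Set (Ambient k) :=
  {x | ∀ (i : ℕ) (h : i + 1 < n) (v : Fin (k (Fin.castSucc ⟨i, Nat.lt_of_succ_lt h⟩)) → ℂ),
    diff x ⟨i + 1, h⟩ (diff x ⟨i, Nat.lt_of_succ_lt h⟩ v) = 0}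

/-- `𝔻_ac(k)`: the acyclic (exact) complexes. -/
def acyclicComplexes (k : Fin (n + 1) → ℕ) : Set (Ambient k) :=
  {x ∈ complexes k | ∀ i, coboundaries x i = cocycles x i}

/-- `𝔻_b(k)`: the complexes with `dim H^i = b_i` for all `i`. -/
def bettiComplexes (k b : Fin (n + 1) → ℕ) : Set (Ambient k) :=
  {x ∈ complexes k | ∀ i, Module.finrank ℂ (cohomology x i) = b i}

/-- The number `∑_j (k_j - b_j) (k_j - ∑_{i ≤ j} (-1)^{i+j} (k_i - b_i))`. -/
def dimFormula (k b : Fin (n + 1) → ℕ) : ℤ :=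
  ∑ j, ((k j : ℤ) - b j) * ((k j : ℤ) - altSum (fun i => (k i : ℤ) - b i) j)

end CochainStrings

/-!
A complex with dimensions `k` and Betti numbers `b` has differentials of ranks
`r_{i+1} = rank d^i` with `k_i = r_i + b_i + r_{i+1}`, so `r` is the string of alternating sums of
`k - b`; admissibility of `k - b` says precisely that this string consists of natural numbers
(`IsRankString`). Thus `𝔻_b(k)` is the set of complexes with prescribed ranks
(`mem_bettiComplexes_iff`), and `b' ≥ b` means that the ranks belonging to `b'` are bounded by those
belonging to `b`. Everything follows from three facts.

* Normal form (`exists_conj_rankComplex`): `∏ GL_{k_j}(ℂ)` acts transitively on `𝔻_b(k)`, with an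
  explicit base point, the complex `rankComplex`. Hence `𝔻_b(k)` is the image of a principal open
  subset of an affine space under a regular map, so it is irreducible and connected in both
  topologies.
* Rank bounds are Zariski closed conditions, so `𝔻_b(k)` is locally closed and its closure lies in
  the set of complexes with ranks at most `r`. Conversely, a complex of smaller ranks in normal form
  becomes one of ranks `r` when the missing entries of `rankComplex` are turned on with a small
  weight (`boundedRankComplexes_subset_closure`). So both closures are given by the rank bounds.
* Charts (`graphChart`): where the top right `r_{i+1} × r_{i+1}` block `W_i` of every `d^i` is
  invertible, let `C_i` be the last `r_{i+1}` columns of `d^i` and `R_i` its first `r_{i+1}` rows.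
  Being of rank `r_{i+1}` means `d^i = C_i W_i⁻¹ R_i`, and then `d^i d^{i-1} = 0` means
  `R_i (C_{i-1} W_{i-1}⁻¹) = 0`, an equation that can be solved for the first `r_i` columns of
  `R_i`, because the first `r_i` rows of `C_{i-1} W_{i-1}⁻¹` form the identity. So there `𝔻_b(k)` is
  the graph of a regular map over the remaining entries of `C_i` and `R_i`, whose number is
  `∑ r_{i+1} (k_{i+1} + b_i)`. The Krull dimension of an open subset of `ℂ^m` being `m`, and the
  tangent space of a graph being the graph of the differential, dimension, local dimension and
  tangent dimension agree at points of the chart (`GraphChart`), and by homogeneity everywhere.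
-/

open MvPolynomial Topology Filter

/-! ### The Zariski topology of affine space -/

/-- The affine space `ℂ^σ`, as a type of its own that carries the Zariski topology. -/
def ZSpace (σ : Type) : Type := σ → ℂ

instance (σ : Type) : TopologicalSpace (ZSpace σ) := zariski σ

namespace ZSpace

variable {σ τ : Type}

lemma isClosed_iff {Z : Set (ZSpace σ)} :
    IsClosed Z ↔ ∃ I : Ideal (MvPolynomial σ ℂ), Z = zeroLocus ℂ I := by
  rw [← isOpen_compl_iff]
  change Zᶜᶜ ∈ _ ↔ _
  rw [compl_compl]
  rfl

lemma isClosed_zeros (p : MvPolynomial σ ℂ) : IsClosed {x : ZSpace σ | eval x p = 0} := by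
  refine isClosed_iff.2 ⟨Ideal.span {p}, ?_⟩
  rw [zeroLocus_span]
  refine Set.ext fun x => ?_
  change eval x p = 0 ↔ ∀ q ∈ ({p} : Set (MvPolynomial σ ℂ)), eval x q = 0
  simp

lemma isOpen_ne (p : MvPolynomial σ ℂ) : IsOpen {x : ZSpace σ | eval x p ≠ 0} :=
  (isClosed_zeros p).isOpen_compl

lemma exists_polynomial_of_mem {U : Set (ZSpace σ)} (hU : IsOpen U) {x : ZSpace σ} (hx : x ∈ U) :
    ∃ p : MvPolynomial σ ℂ, eval x p ≠ 0 ∧ ∀ y : ZSpace σ, eval y p ≠ 0 → y ∈ U := by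
  obtain ⟨I, hI⟩ := isClosed_iff.1 hU.isClosed_compl
  have hmem : ∀ y : σ → ℂ, (∀ p ∈ I, eval y p = 0) ↔ y ∉ U := fun y => by
    change y ∈ zeroLocus ℂ I ↔ y ∈ Uᶜ
    rw [hI]
    rfl
  have h := mt (hmem x).1 (not_not.2 hx)
  push Not at h
  obtain ⟨p, hp, hpx⟩ := h
  exact ⟨p, hpx, fun y hy => by_contra fun hyU => hy ((hmem y).2 hyU p hp)⟩

/-- The Euclidean topology is finer than the Zariski topology. -/
lemma isClosed_euclidean {Z : Set (ZSpace σ)} (hZ : IsClosed Z) :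
    IsClosed (X := σ → ℂ) Z := by
  obtain ⟨I, rfl⟩ := isClosed_iff.1 hZ
  have : zeroLocus ℂ I = ⋂ p ∈ I, {x : σ → ℂ | eval x p = 0} := by
    ext x
    simp
  rw [this]
  exact isClosed_biInter fun p _ => isClosed_eq p.continuous_eval continuous_const

lemma isOpen_euclidean {U : Set (ZSpace σ)} (hU : IsOpen U) : IsOpen (X := σ → ℂ) U :=
  isClosed_compl_iff.1 (isClosed_euclidean hU.isClosed_compl)

instance : IrreducibleSpace (ZSpace σ) where
  isPreirreducible_univ := by
    rintro U V hU hV ⟨x, -, hx⟩ ⟨y, -, hy⟩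
    obtain ⟨p, hpx, hp⟩ := exists_polynomial_of_mem hU hx
    obtain ⟨q, hqy, hq⟩ := exists_polynomial_of_mem hV hy
    have hpq : p * q ≠ 0 :=
      mul_ne_zero (by rintro rfl; simp at hpx) (by rintro rfl; simp at hqy)
    have : ∃ z : σ → ℂ, eval z (p * q) ≠ 0 := by
      by_contra! h
      exact hpq (MvPolynomial.funext fun z => by simpa using h z)
    obtain ⟨z, hz⟩ := this
    rw [map_mul] at hz
    exact ⟨z, Set.mem_univ _, hp z (left_ne_zero_of_mul hz), hq z (right_ne_zero_of_mul hz)⟩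
  toNonempty := ⟨fun _ => (0 : ℂ)⟩

end ZSpace

/-! ### Regular functions on a principal open set -/

/-- `g` restricts to a regular function `P / f ^ m` on the principal open set `f ≠ 0`. -/
def RegularOff {σ : Type} (f : MvPolynomial σ ℂ) (g : (σ → ℂ) → ℂ) : Prop :=
  ∃ (P : MvPolynomial σ ℂ) (m : ℕ), ∀ x, eval x f ≠ 0 → eval x f ^ m * g x = eval x P

namespace RegularOff

variable {σ τ : Type} {f : MvPolynomial σ ℂ}

lemma polynomial (p : MvPolynomial σ ℂ) : RegularOff f fun x => eval x p := ⟨p, 0, by simp⟩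

lemma const (c : ℂ) : RegularOff f fun _ => c := ⟨C c, 0, by simp⟩

lemma coord (s : σ) : RegularOff f fun x => x s := ⟨X s, 0, by simp⟩

lemma add {g h : (σ → ℂ) → ℂ} (hg : RegularOff f g) (hh : RegularOff f h) :
    RegularOff f fun x => g x + h x := by
  obtain ⟨P, m, hP⟩ := hg
  obtain ⟨Q, l, hQ⟩ := hh
  refine ⟨f ^ l * P + f ^ m * Q, m + l, fun x hx => ?_⟩
  simp only [map_add, map_mul, map_pow, ← hP x hx, ← hQ x hx]
  ring

lemma mul {g h : (σ → ℂ) → ℂ} (hg : RegularOff f g) (hh : RegularOff f h) :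
    RegularOff f fun x => g x * h x := by
  obtain ⟨P, m, hP⟩ := hg
  obtain ⟨Q, l, hQ⟩ := hh
  refine ⟨P * Q, m + l, fun x hx => ?_⟩
  simp only [map_mul, ← hP x hx, ← hQ x hx]
  ring

lemma neg {g : (σ → ℂ) → ℂ} (hg : RegularOff f g) : RegularOff f fun x => - g x := by
  simpa using (const (f := f) (-1)).mul hg

lemma sum {ι : Type*} (s : Finset ι) {g : ι → (σ → ℂ) → ℂ} (hg : ∀ i ∈ s, RegularOff f (g i)) :
    RegularOff f fun x => ∑ i ∈ s, g i x := by
  classical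
  induction s using Finset.induction_on with
  | empty => simpa using const 0
  | insert a s ha ih =>
    simp only [Finset.sum_insert ha]
    exact (hg a (by simp)).add (ih fun i hi => hg i (by simp [hi]))

/-- If `g` times a divisor of `f` is a polynomial, then `g` is regular where `f ≠ 0`. -/
lemma of_dvd {g : (σ → ℂ) → ℂ} (d P : MvPolynomial σ ℂ) (hd : d ∣ f)
    (hg : ∀ x, eval x f ≠ 0 → eval x d * g x = eval x P) : RegularOff f g := by
  obtain ⟨e, rfl⟩ := hd
  refine ⟨e * P, 1, fun x hx => ?_⟩
  rw [map_mul, map_mul, ← hg x hx]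
  ring

/-- Regular maps pull polynomials back to regular functions. -/
lemma eval_comp {ψ : (σ → ℂ) → τ → ℂ} (hψ : ∀ t, RegularOff f fun x => ψ x t)
    (p : MvPolynomial τ ℂ) : RegularOff f fun x => eval (ψ x) p := by
  induction p using MvPolynomial.induction_on with
  | C a => simpa using const a
  | add p q hp hq => simpa using hp.add hq
  | mul_X p t hp => simpa using hp.mul (hψ t)

/-- Regular maps are continuous for the Zariski topology. -/
lemma continuousOn {ψ : (σ → ℂ) → τ → ℂ} (hψ : ∀ t, RegularOff f fun x => ψ x t) :
    ContinuousOn (X := ZSpace σ) (Y := ZSpace τ) ψ {x | eval x f ≠ 0} := by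
  refine continuousOn_iff_isClosed.2 fun Z hZ => ?_
  obtain ⟨I, rfl⟩ := ZSpace.isClosed_iff.1 hZ
  choose P m hP using fun p => eval_comp hψ p
  refine ⟨⋂ p ∈ I, {x | eval x (P p) = 0},
    isClosed_biInter fun p _ => ZSpace.isClosed_zeros _, ?_⟩
  refine Set.ext fun x => ?_
  rw [Set.mem_inter_iff, Set.mem_inter_iff, Set.mem_iInter₂]
  refine and_congr_left fun hx => forall₂_congr fun p _ => ?_
  change eval (ψ x) p = 0 ↔ eval x (P p) = 0
  rw [← hP p x hx, mul_eq_zero, or_iff_right (pow_ne_zero _ hx)]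

lemma differentiableAt {g : (σ → ℂ) → ℂ} (hg : RegularOff f g) {γ : ℂ → σ → ℂ} {t : ℂ}
    (hγ : ∀ p : MvPolynomial σ ℂ, Differentiable ℂ fun t => eval (γ t) p)
    (hf : eval (γ t) f ≠ 0) : DifferentiableAt ℂ (fun t => g (γ t)) t := by
  obtain ⟨P, m, hP⟩ := hg
  have h : DifferentiableAt ℂ (fun t => eval (γ t) P / eval (γ t) f ^ m) t :=
    (hγ P t).div ((hγ f t).pow m) (pow_ne_zero _ hf)
  refine h.congr_of_eventuallyEq ?_
  filter_upwards [(hγ f).continuous.continuousAt.eventually_ne hf] with s hs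
  rw [← hP _ hs, mul_div_cancel_left₀ _ (pow_ne_zero _ hs)]

end RegularOff

/-- Polynomial maps are continuous for the Zariski topology. -/
lemma ZSpace.continuous_of_eval {σ τ : Type} {φ : ZSpace σ → ZSpace τ} (Φ : τ → MvPolynomial σ ℂ)
    (h : ∀ (x : σ → ℂ) (t : τ), eval x (Φ t) = φ x t) : Continuous φ := by
  have h' := RegularOff.continuousOn (f := (1 : MvPolynomial σ ℂ))
    (ψ := fun x t => eval x (Φ t)) fun t => RegularOff.polynomial (Φ t)
  have h'' : φ = fun x : σ → ℂ => fun t => eval x (Φ t) :=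
    _root_.funext fun x => _root_.funext fun t => (h x t).symm
  rw [h'']
  refine continuousOn_univ.1 (h'.mono fun x _ => ?_)
  change eval x (1 : MvPolynomial σ ℂ) ≠ 0
  simp

lemma eval_X_sub_C_eq_zero {σ : Type} (x : σ → ℂ) (s : σ) (c : ℂ) :
    eval x (X s - C c) = 0 ↔ x s = c := by
  simp [sub_eq_zero]

/-! ### Krull dimension of open subsets of affine space -/

namespace ZSpace

variable {σ τ : Type}

/-- The upper bound `dim ℂ^σ ≤ #σ`: irreducible closed subsets have prime vanishing ideals, and
the polynomial ring has Krull dimension `#σ`. -/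
lemma topologicalKrullDim_le [Finite σ] : topologicalKrullDim (ZSpace σ) ≤ Nat.card σ := by
  have hprime : ∀ Z : TopologicalSpace.IrreducibleCloseds (ZSpace σ),
      (vanishingIdeal ℂ (Z.carrier : Set (σ → ℂ))).IsPrime := by
    intro Z
    refine ⟨?_, ?_⟩
    · intro h
      obtain ⟨x, hx⟩ := Z.isIrreducible.nonempty
      have h1 : (1 : MvPolynomial σ ℂ) ∈ vanishingIdeal ℂ (Z.carrier : Set (σ → ℂ)) := by
        rw [h]; trivial
      simpa using h1 x hx
    · intro p q hpq
      have h := isPreirreducible_iff_isClosed_union_isClosed.1 Z.isIrreducible.isPreirreducible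
        _ _ (isClosed_zeros p) (isClosed_zeros q) (fun x hx => by
          have h : eval (x : σ → ℂ) (p * q) = 0 := hpq x hx
          rw [map_mul, mul_eq_zero] at h
          exact h)
      exact h.imp (fun h x hx => h hx) (fun h x hx => h hx)
  have hle : ∀ Z W : TopologicalSpace.IrreducibleCloseds (ZSpace σ),
      vanishingIdeal ℂ (Z.carrier : Set (σ → ℂ)) ≤ vanishingIdeal ℂ (W.carrier : Set (σ → ℂ)) → W ≤ Z := by
    intro Z W h x hx
    obtain ⟨I, hI⟩ := isClosed_iff.1 Z.isClosed
    have hIZ : I ≤ vanishingIdeal ℂ (Z.carrier : Set (σ → ℂ)) := by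
      have := le_vanishingIdeal_zeroLocus (K := ℂ) I
      rwa [← hI] at this
    change x ∈ (Z : Set (ZSpace σ))
    rw [hI]
    exact fun p hp => h (hIZ hp) x hx
  let F : TopologicalSpace.IrreducibleCloseds (ZSpace σ) →
      (PrimeSpectrum (MvPolynomial σ ℂ))ᵒᵈ :=
    fun Z => OrderDual.toDual ⟨vanishingIdeal ℂ (Z.carrier : Set (σ → ℂ)), hprime Z⟩
  have hF : StrictMono F := by
    intro Z W h
    refine lt_of_le_not_ge ?_ fun h' => ?_
    · change vanishingIdeal ℂ (W.carrier : Set (σ → ℂ)) ≤ vanishingIdeal ℂ (Z.carrier : Set (σ → ℂ))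
      exact vanishingIdeal_anti_mono h.le
    · exact h.not_ge (hle _ _ h')
  refine (Order.krullDim_le_of_strictMono F hF).trans ?_
  rw [Order.krullDim_orderDual]
  change ringKrullDim (MvPolynomial σ ℂ) ≤ _
  rw [MvPolynomial.ringKrullDim_of_isNoetherianRing, ringKrullDim_eq_zero_of_field, zero_add]

/-- The lower bound: the flag of coordinate planes through a point of `U`, cut with `U`, is a
chain of irreducible closed subsets. -/
lemma card_le_topologicalKrullDim [Finite σ] {U : Set (ZSpace σ)} (hU : IsOpen U)
    (hne : U.Nonempty) : (Nat.card σ : WithBot ℕ∞) ≤ topologicalKrullDim U := by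
  obtain ⟨p, hp⟩ := hne
  let e : σ ≃ Fin (Nat.card σ) := Finite.equivFin σ
  let φ : ℕ → ZSpace σ → ZSpace σ := fun j z s => if (e s : ℕ) < j then z s else p s
  have hφc : ∀ j, Continuous (φ j) := by
    intro j
    refine continuous_of_eval (fun s => if (e s : ℕ) < j then X s else C (p s)) fun z s => ?_
    change eval z (if (e s : ℕ) < j then X s else C (p s)) = if (e s : ℕ) < j then z s else p s
    split_ifs <;> simp
  have hφp : ∀ j, φ j p = p := fun j => by funext s; simp [φ]
  let L : ℕ → Set U := fun j => {x | ∀ s, j ≤ (e s : ℕ) → x.1 s = p s}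
  have hLc : ∀ j, IsClosed (L j) := by
    intro j
    have : L j = Subtype.val ⁻¹' (⋂ (s : σ) (_ : j ≤ (e s : ℕ)),
        {x : ZSpace σ | eval x (X s - C (p s)) = 0}) := by
      refine Set.ext fun x => ?_
      rw [Set.mem_preimage, Set.mem_iInter₂]
      refine forall₂_congr fun s _ => ?_
      exact (eval_X_sub_C_eq_zero x.1 s (p s)).symm
    rw [this]
    exact (isClosed_iInter fun s => isClosed_iInter fun _ => isClosed_zeros _).preimage
      continuous_subtype_val
  have hLi : ∀ j, IsIrreducible (L j) := by
    intro j
    have hV : IsOpen (φ j ⁻¹' U) := hU.preimage (hφc j)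
    have : Nonempty (φ j ⁻¹' U) := ⟨⟨p, by simp [hφp, hp]⟩⟩
    have : IrreducibleSpace (φ j ⁻¹' U) := hV.isOpenEmbedding_subtypeVal.irreducibleSpace
    have h := (IrreducibleSpace.isIrreducible_univ (φ j ⁻¹' U)).image
      (fun z => (⟨φ j z.1, z.2⟩ : U))
      (Continuous.subtype_mk ((hφc j).comp continuous_subtype_val) _).continuousOn
    convert h using 1
    ext x
    simp only [Set.image_univ, Set.mem_range, L, Set.mem_ofPred_eq]
    constructor
    · intro hx
      have hx' : φ j x.1 = x.1 := by
        funext s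
        simp only [φ]
        split_ifs with h
        · rfl
        · exact (hx s (not_lt.1 h)).symm
      exact ⟨⟨x.1, by simp [hx']⟩, Subtype.ext hx'⟩
    · rintro ⟨z, rfl⟩ s hs
      simp [φ, not_lt.2 hs]
  have hlt : ∀ j : ℕ, j < Nat.card σ → L j < L (j + 1) := by
    intro j hj
    refine lt_of_le_not_ge (fun x hx s hs => hx s (by omega)) fun h => ?_
    -- move a little from `p` in the direction of the `j`-th coordinate
    let s₀ := e.symm ⟨j, hj⟩
    classical
    let γ : ℂ → σ → ℂ := fun t => Function.update p s₀ (p s₀ + t)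
    have hγ : Continuous γ :=
      continuous_const.update _ (continuous_const.add continuous_id)
    have hO : IsOpen (γ ⁻¹' U) := (isOpen_euclidean hU).preimage hγ
    have hγ0 : γ 0 = p := by simp only [γ, add_zero]; exact Function.update_eq_self s₀ p
    have h0 : (0 : ℂ) ∈ γ ⁻¹' U := by
      change (γ 0 : ZSpace σ) ∈ U
      rw [hγ0]
      exact hp
    have hev : ∀ᶠ t in 𝓝[≠] (0 : ℂ), t ∈ γ ⁻¹' U :=
      nhdsWithin_le_nhds (hO.mem_nhds h0)
    obtain ⟨t, htU, ht0⟩ := (hev.and self_mem_nhdsWithin).exists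
    have hmem : (⟨γ t, htU⟩ : U) ∈ L (j + 1) := by
      intro s hs
      have : s ≠ s₀ := by
        rintro rfl
        simp [s₀] at hs
      exact Function.update_of_ne this _ p
    have h1 : γ t s₀ = p s₀ := h hmem s₀ (by simp [s₀])
    have h2 : γ t s₀ = p s₀ + t := Function.update_self s₀ _ p
    exact ht0 (by simpa [h2] using h1)
  let S : LTSeries (TopologicalSpace.IrreducibleCloseds U) :=
    { length := Nat.card σ
      toFun := fun j => ⟨L j, hLi j, hLc j⟩
      step := fun j => hlt j j.2 }
  exact Order.LTSeries.length_le_krullDim S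

lemma topologicalKrullDim_eq [Finite σ] {U : Set (ZSpace σ)} (hU : IsOpen U) (hne : U.Nonempty) :
    topologicalKrullDim U = Nat.card σ :=
  le_antisymm ((topologicalKrullDim_subspace_le _ U).trans topologicalKrullDim_le)
    (card_le_topologicalKrullDim hU hne)

end ZSpace

/-- The Krull dimension is bounded by the dimensions of the members of an open cover. -/
lemma topologicalKrullDim_le_of_forall_exists_isOpen {X : Type*} [TopologicalSpace X]
    {d : WithBot ℕ∞}
    (h : ∀ x : X, ∃ U : Set X, IsOpen U ∧ x ∈ U ∧ topologicalKrullDim U ≤ d) :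
    topologicalKrullDim X ≤ d := by
  refine iSup_le fun p => ?_
  obtain ⟨x, hx⟩ := p.head.isIrreducible.nonempty
  obtain ⟨U, hU, hxU, hd⟩ := h x
  let e := TopologicalSpace.IrreducibleCloseds.orderIsoOfIsOpenEmbedding (Subtype.val : U → X)
    hU.isOpenEmbedding_subtypeVal
  let q : LTSeries (TopologicalSpace.IrreducibleCloseds U) :=
    { length := p.length
      toFun := fun i => e.symm ⟨p i, ⟨⟨x, hxU⟩, (LTSeries.head_le p i : _) hx⟩⟩
      step := fun i => e.symm.strictMono (p.step i) }
  exact (Order.LTSeries.length_le_krullDim q).trans hd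

/-! ### Zariski tangent spaces -/

/-- The chain rule for a polynomial along a curve. -/
lemma hasDerivAt_eval {σ : Type} [Fintype σ] (f : MvPolynomial σ ℂ) {γ : ℂ → σ → ℂ} {v : σ → ℂ}
    {t : ℂ} (hγ : ∀ s, HasDerivAt (fun u => γ u s) (v s) t) :
    HasDerivAt (fun u => eval (γ u) f) (∑ s, eval (γ t) (pderiv s f) * v s) t := by
  classical
  induction f using MvPolynomial.induction_on with
  | C a => simpa using hasDerivAt_const t a
  | add p q hp hq =>
    simp only [map_add, add_mul, Finset.sum_add_distrib]
    exact hp.add hq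
  | mul_X p s hp =>
    have h := hp.mul (hγ s)
    simp only [map_mul, eval_X]
    convert! h using 1
    simp only [Derivation.leibniz, smul_eq_mul, map_add, map_mul, eval_X, add_mul,
      Finset.sum_add_distrib, Finset.sum_mul, pderiv_X]
    rw [add_comm]
    congr 1
    · exact Finset.sum_congr rfl fun _ _ => by ring
    · rw [Finset.sum_eq_single s]
      · simp
      · intro b _ hb
        simp [hb.symm]
      · simp

lemma hasDerivAt_line {σ : Type} (x v : σ → ℂ) (t : ℂ) (s : σ) :
    HasDerivAt (fun u : ℂ => (x + u • v) s) (v s) t := by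
  simpa using ((hasDerivAt_id t).mul_const (v s)).const_add (x s)

lemma differentiable_eval_line {σ : Type} [Finite σ] (x v : σ → ℂ) (p : MvPolynomial σ ℂ) :
    Differentiable ℂ fun t : ℂ => eval (x + t • v) p := by
  have := Fintype.ofFinite σ
  exact fun t => (hasDerivAt_eval p (hasDerivAt_line x v t)).differentiableAt

/-- Velocities of differentiable curves in `S` are tangent vectors. -/
lemma mem_zariskiTangentSpace_of_curve {σ : Type} [Fintype σ] {S : Set (σ → ℂ)} {x v : σ → ℂ}
    {γ : ℂ → σ → ℂ} (hγ : ∀ s, HasDerivAt (fun u => γ u s) (v s) 0) (h0 : γ 0 = x)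
    (hS : ∀ᶠ u in 𝓝 (0 : ℂ), γ u ∈ S) : v ∈ zariskiTangentSpace S x := by
  intro f hf
  have h1 := hasDerivAt_eval f hγ
  rw [h0] at h1
  refine h1.unique ((hasDerivAt_const (0 : ℂ) (0 : ℂ)).congr_of_eventuallyEq ?_)
  filter_upwards [hS] with u hu
  exact hf _ hu

lemma hasDerivAt_eval_of_mem_zariskiTangentSpace {σ : Type} [Fintype σ] {S : Set (σ → ℂ)}
    {x v : σ → ℂ} (hv : v ∈ zariskiTangentSpace S x) {f : MvPolynomial σ ℂ}
    (hf : f ∈ vanishingIdeal ℂ S) : HasDerivAt (fun u : ℂ => eval (x + u • v) f) 0 0 := by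
  have h := hasDerivAt_eval f (hasDerivAt_line x v 0)
  simp only [zero_smul, add_zero] at h
  rwa [hv f hf] at h

lemma exists_eval_eq_eval_linearMap {σ τ : Type} [Finite σ] (L : (σ → ℂ) →ₗ[ℂ] (τ → ℂ))
    (f : MvPolynomial τ ℂ) : ∃ g : MvPolynomial σ ℂ, ∀ x, eval x g = eval (L x) f := by
  classical
  have := Fintype.ofFinite σ
  refine ⟨bind₁ (fun t => ∑ s, C (L (Pi.single s 1) t) * X s) f, fun x => ?_⟩
  rw [← aeval_eq_eval, ← aeval_eq_eval, aeval_bind₁]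
  congr 2
  funext t
  conv_rhs => rw [pi_eq_sum_univ' x]
  simp only [map_sum, map_smul, Finset.sum_apply, Pi.smul_apply, smul_eq_mul, map_mul, aeval_X,
    aeval_C, Algebra.algebraMap_self, RingHom.id_apply]
  exact Finset.sum_congr rfl fun s _ => mul_comm _ _

lemma map_mem_zariskiTangentSpace {σ : Type} [Fintype σ] {S : Set (σ → ℂ)} {x v : σ → ℂ}
    (L : (σ → ℂ) →ₗ[ℂ] (σ → ℂ)) (hL : ∀ y ∈ S, L y ∈ S) (hv : v ∈ zariskiTangentSpace S x) :
    L v ∈ zariskiTangentSpace S (L x) := by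
  intro f hf
  obtain ⟨g, hg⟩ := exists_eval_eq_eval_linearMap L f
  have hgS : g ∈ vanishingIdeal ℂ S := fun y hy => by
    rw [aeval_eq_eval]
    exact (hg y).trans (hf _ (hL y hy))
  have h1 := hasDerivAt_eval_of_mem_zariskiTangentSpace hv hgS
  have h2 := hasDerivAt_eval f (hasDerivAt_line (L x) (L v) 0)
  simp only [hg, map_add, map_smul] at h1
  simp only [zero_smul, add_zero] at h2
  exact h2.unique h1

lemma finrank_zariskiTangentSpace_linearEquiv {σ : Type} [Fintype σ] {S : Set (σ → ℂ)}
    (x : σ → ℂ) (L : (σ → ℂ) ≃ₗ[ℂ] (σ → ℂ)) (hL : ∀ y, L y ∈ S ↔ y ∈ S) :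
    Module.finrank ℂ (zariskiTangentSpace S (L x)) =
      Module.finrank ℂ (zariskiTangentSpace S x) := by
  have : zariskiTangentSpace S (L x) = (zariskiTangentSpace S x).map (L : _ →ₗ[ℂ] (σ → ℂ)) := by
    refine le_antisymm (fun v hv => ?_) ?_
    · refine ⟨L.symm v, ?_, by simp⟩
      have := map_mem_zariskiTangentSpace (L.symm : (σ → ℂ) →ₗ[ℂ] (σ → ℂ))
        (fun y hy => (hL _).1 (by simpa using hy)) hv
      simpa using this
    · rintro _ ⟨v, hv, rfl⟩
      exact map_mem_zariskiTangentSpace (L : (σ → ℂ) →ₗ[ℂ] (σ → ℂ)) (fun y hy => (hL y).2 hy) hv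
  rw [this]
  exact LinearEquiv.finrank_map_eq L _

lemma ZSpace.continuous_linearMap {σ τ : Type} [Finite σ] (L : (σ → ℂ) →ₗ[ℂ] (τ → ℂ)) :
    Continuous (X := ZSpace σ) (Y := ZSpace τ) L := by
  choose g hg using fun t => exists_eval_eq_eval_linearMap L (X t)
  exact ZSpace.continuous_of_eval g fun x t => by simp [hg]

lemma zariskiDim_eq_topologicalKrullDim {σ : Type} (S : Set (ZSpace σ)) :
    zariskiDim (σ := σ) S = topologicalKrullDim S := rfl

/-! ### Sets that are locally graphs of regular maps -/

/-- On the principal open set `f ≠ 0` the set `S` is the graph of a regular map, which expresses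
all coordinates through those singled out by `free`. The map is encoded as a retraction `Ψ` onto
`S` that depends only on the free coordinates of its argument. -/
structure GraphChart {σ : Type} (S : Set (σ → ℂ)) (f : MvPolynomial σ ℂ) (free : σ → Prop)
    (Ψ : (σ → ℂ) → σ → ℂ) : Prop where
  regular : ∀ s, RegularOff f fun x => Ψ x s
  apply_free : ∀ x, eval x f ≠ 0 → ∀ s, free s → Ψ x s = x s
  congr_map : ∀ x y, (∀ s, free s → x s = y s) → Ψ x = Ψ y
  congr_eval : ∀ x y, (∀ s, free s → x s = y s) → eval x f = eval y f
  map_mem : ∀ x, eval x f ≠ 0 → Ψ x ∈ S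
  map_eq : ∀ x ∈ S, eval x f ≠ 0 → Ψ x = x

namespace GraphChart

variable {σ : Type} {S : Set (σ → ℂ)} {f : MvPolynomial σ ℂ} {free : σ → Prop}
  {Ψ : (σ → ℂ) → σ → ℂ}

/-- A tangent vector is determined by its free coordinates: the equations `f ^ m * x_s = P_s` of
the graph, multiplied by `f`, vanish on all of `S`. -/
lemma eq_zero_of_mem_zariskiTangentSpace [Fintype σ] (h : GraphChart S f free Ψ) {x v : σ → ℂ} (hx : x ∈ S)
    (hf : eval x f ≠ 0) (hv : v ∈ zariskiTangentSpace S x) (hv0 : ∀ s, free s → v s = 0) :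
    v = 0 := by
  funext s
  obtain ⟨P, m, hP⟩ := h.regular s
  have hmem : f * (f ^ m * X s - P) ∈ vanishingIdeal ℂ S := by
    intro y hy
    rw [aeval_eq_eval]
    change eval y _ = 0
    by_cases hfy : eval y f = 0
    · simp [hfy]
    · simp [← hP y hfy, h.map_eq y hy hfy]
  have h1 := hasDerivAt_eval_of_mem_zariskiTangentSpace hv hmem
  have hagree : ∀ u : ℂ, ∀ s, free s → (x + u • v) s = x s := fun u s hs => by simp [hv0 s hs]
  have hfu : ∀ u : ℂ, eval (x + u • v) f = eval x f := fun u => h.congr_eval _ _ (hagree u)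
  have hPu : ∀ u : ℂ, eval (x + u • v) P = eval x f ^ m * x s := fun u => by
    rw [← hP _ (by rwa [hfu]), hfu]
    change _ * Ψ (x + u • v) s = _
    rw [h.congr_map _ _ (hagree u), h.map_eq x hx hf]
  have h2 : HasDerivAt (fun u : ℂ => eval (x + u • v) (f * (f ^ m * X s - P)))
      (eval x f * (eval x f ^ m * v s)) 0 := by
    simp only [map_mul, map_sub, map_pow, eval_X, hfu, hPu]
    exact (((hasDerivAt_line x v 0 s).const_mul _).sub_const _).const_mul _
  have h3 := h2.unique h1
  simpa [hf] using h3

/-- Every vector of free coordinates is realised by a tangent vector: the velocity of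
`u ↦ Ψ (x + u w)`. -/
lemma exists_mem_zariskiTangentSpace [Fintype σ] (h : GraphChart S f free Ψ) {x : σ → ℂ} (hx : x ∈ S)
    (hf : eval x f ≠ 0) (w : σ → ℂ) :
    ∃ v ∈ zariskiTangentSpace S x, ∀ s, free s → v s = w s := by
  have hne : ∀ᶠ u in 𝓝 (0 : ℂ), eval (x + u • w) f ≠ 0 :=
    (differentiable_eval_line x w f).continuous.continuousAt.eventually_ne (by simpa using hf)
  have hd : ∀ s, DifferentiableAt ℂ (fun u : ℂ => Ψ (x + u • w) s) 0 := fun s =>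
    (h.regular s).differentiableAt (differentiable_eval_line x w) (by simpa using hf)
  refine ⟨fun s => deriv (fun u : ℂ => Ψ (x + u • w) s) 0,
    mem_zariskiTangentSpace_of_curve (γ := fun u => Ψ (x + u • w)) (fun s => (hd s).hasDerivAt)
      ?_ ?_, fun s hs => ?_⟩
  · simpa using h.map_eq x hx hf
  · filter_upwards [hne] with u hu using h.map_mem _ hu
  · refine (hd s).hasDerivAt.unique ((hasDerivAt_line x w 0 s).congr_of_eventuallyEq ?_)
    filter_upwards [hne] with u hu using h.apply_free _ hu s hs

lemma finrank_zariskiTangentSpace [Fintype σ] (h : GraphChart S f free Ψ) {x : σ → ℂ} (hx : x ∈ S)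
    (hf : eval x f ≠ 0) :
    Module.finrank ℂ (zariskiTangentSpace S x) = Nat.card {s // free s} := by
  have := Fintype.ofFinite {s // free s}
  let R : zariskiTangentSpace S x →ₗ[ℂ] ({s // free s} → ℂ) :=
    LinearMap.funLeft ℂ ℂ Subtype.val ∘ₗ (zariskiTangentSpace S x).subtype
  have hR : Function.Bijective R := by
    constructor
    · rw [← LinearMap.ker_eq_bot, LinearMap.ker_eq_bot']
      rintro ⟨v, hv⟩ h0
      exact Subtype.ext (h.eq_zero_of_mem_zariskiTangentSpace hx hf hv
        fun s hs => congrFun h0 ⟨s, hs⟩)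
    · intro w
      obtain ⟨v, hv, hvw⟩ := h.exists_mem_zariskiTangentSpace hx hf
        (Function.extend Subtype.val w 0)
      refine ⟨⟨v, hv⟩, funext fun s => ?_⟩
      change v s = w s
      rw [hvw s s.2, Subtype.val_injective.extend_apply]
  rw [(LinearEquiv.ofBijective R hR).finrank_eq, Module.finrank_fintype_fun_eq_card,
    Nat.card_eq_fintype_card]

/-- The parametrisation of a neighbourhood in `S` by the free coordinates, followed by a linear
change of coordinates. -/
lemma continuousOn_param [Fintype σ] (h : GraphChart S f free Ψ) (L : (σ → ℂ) ≃ₗ[ℂ] (σ → ℂ)) :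
    ContinuousOn (X := ZSpace {s // free s}) (Y := ZSpace σ)
      (fun a => L.symm (Ψ (Function.extend Subtype.val a 0)))
      {a | eval (Function.extend Subtype.val a 0) f ≠ 0} := by
  have h1 : Continuous (X := ZSpace {s // free s}) (Y := ZSpace σ)
      (fun a => Function.extend Subtype.val a 0) :=
    ZSpace.continuous_linearMap (Function.ExtendByZero.linearMap ℂ (Subtype.val : {s // free s} → σ))
  have h2 := ZSpace.continuous_linearMap (L.symm : (σ → ℂ) →ₗ[ℂ] (σ → ℂ))
  exact h2.comp_continuousOn ((RegularOff.continuousOn h.regular).comp h1.continuousOn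
    fun a ha => ha)

lemma isOpen_param [Fintype σ] (f : MvPolynomial σ ℂ) (free : σ → Prop) :
    IsOpen (X := ZSpace {s // free s}) {a | eval (Function.extend Subtype.val a 0) f ≠ 0} := by
  obtain ⟨g, hg⟩ := exists_eval_eq_eval_linearMap
    (Function.ExtendByZero.linearMap ℂ (Subtype.val : {s // free s} → σ)) f
  have h : {a : {s // free s} → ℂ | eval (Function.extend Subtype.val a 0) f ≠ 0} =
      {a | eval a g ≠ 0} := by
    ext a
    rw [Set.mem_ofPred_eq, Set.mem_ofPred_eq, hg]
    rfl
  exact h ▸ ZSpace.isOpen_ne g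

lemma continuous_coords [Fintype σ] (free : σ → Prop) (L : (σ → ℂ) ≃ₗ[ℂ] (σ → ℂ)) :
    Continuous (X := ZSpace σ) (Y := ZSpace {s // free s}) (fun x s => L x s) :=
  ZSpace.continuous_linearMap
    (LinearMap.funLeft ℂ ℂ Subtype.val ∘ₗ (L : (σ → ℂ) →ₗ[ℂ] (σ → ℂ)))

lemma extend_apply {x : σ → ℂ} {s : σ} (hs : free s) :
    Function.extend (Subtype.val : {s // free s} → σ) (fun t => x t) 0 s = x s :=
  Subtype.val_injective.extend_apply (fun t : {s // free s} => x t) 0 ⟨s, hs⟩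

lemma param_coords (h : GraphChart S f free Ψ) {x : σ → ℂ} (hx : x ∈ S) (hf : eval x f ≠ 0) :
    Ψ (Function.extend (Subtype.val : {s // free s} → σ) (fun t => x t) 0) = x :=
  (h.congr_map _ _ fun _ => extend_apply).trans (h.map_eq x hx hf)

lemma coords_param (h : GraphChart S f free Ψ) {a : {s // free s} → ℂ}
    (ha : eval (Function.extend Subtype.val a 0) f ≠ 0) :
    (fun s : {s // free s} => Ψ (Function.extend Subtype.val a 0) s) = a :=
  funext fun s => by rw [h.apply_free _ ha s s.2, Subtype.val_injective.extend_apply]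

/-- A subset of `S` that some linear symmetry of `S` moves into the chart has dimension at most the
number of free coordinates, since it embeds into their affine space. -/
lemma zariskiDim_le [Fintype σ] (h : GraphChart S f free Ψ) (L : (σ → ℂ) ≃ₗ[ℂ] (σ → ℂ))
    (hL : ∀ y, L y ∈ S ↔ y ∈ S) {T : Set (ZSpace σ)} (hT : T ⊆ S)
    (hTf : ∀ x ∈ T, eval (L x) f ≠ 0) :
    zariskiDim (σ := σ) T ≤ Nat.card {s // free s} := by
  rw [zariskiDim_eq_topologicalKrullDim]
  let V : Set (ZSpace {s // free s}) := {a | eval (Function.extend Subtype.val a 0) f ≠ 0}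
  have hV : ∀ x ∈ T, (fun s : {s // free s} => L x s) ∈ V := fun x hx => by
    change eval _ f ≠ 0
    rw [h.congr_eval _ _ fun _ => extend_apply]
    exact hTf x hx
  let F : T → V := fun x => ⟨fun s => L x.1 s, hV x.1 x.2⟩
  have hF : Continuous F :=
    Continuous.subtype_mk ((continuous_coords free L).comp continuous_subtype_val) _
  have hG := continuousOn_iff_continuous_domRestrict.1 (h.continuousOn_param L)
  have hFG : IsInducing (V.domRestrict (fun a => L.symm (Ψ (Function.extend Subtype.val a 0))) ∘ F :
      T → ZSpace σ) := by
    have : (V.domRestrict (fun a => L.symm (Ψ (Function.extend Subtype.val a 0))) ∘ F :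
        T → ZSpace σ) = Subtype.val := by
      refine _root_.funext fun x => ?_
      change L.symm (Ψ (Function.extend Subtype.val (fun s : {s // free s} => L x.1 s) 0)) = x.1
      rw [h.param_coords ((hL _).2 (hT x.2)) (hTf x.1 x.2)]
      exact L.symm_apply_apply x.1
    rw [this]
    exact IsInducing.subtypeVal
  exact ((IsInducing.of_comp hF hG hFG).topologicalKrullDim_le).trans
    ((topologicalKrullDim_subspace_le _ V).trans ZSpace.topologicalKrullDim_le)

/-- If a linear symmetry of `S` moves `x` into the chart, then every neighbourhood of `x` in `S` has
dimension at least the number of free coordinates, since a non-empty open subset of their affine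
space embeds into it. -/
lemma le_zariskiDim [Fintype σ] (h : GraphChart S f free Ψ) (L : (σ → ℂ) ≃ₗ[ℂ] (σ → ℂ))
    (hL : ∀ y, L y ∈ S ↔ y ∈ S) {x : σ → ℂ} (hx : x ∈ S) (hf : eval (L x) f ≠ 0)
    {U : Set (σ → ℂ)} (hU : IsOpen (X := ZSpace σ) U) (hxU : x ∈ U) :
    (Nat.card {s // free s} : WithBot ℕ∞) ≤ zariskiDim (S ∩ U) := by
  let T : Set (ZSpace σ) := S ∩ U
  change _ ≤ zariskiDim (σ := σ) T
  rw [zariskiDim_eq_topologicalKrullDim]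
  let ψ : ZSpace {s // free s} → ZSpace σ :=
    fun a => L.symm (Ψ (Function.extend Subtype.val a 0))
  let V : Set (ZSpace {s // free s}) := {a | eval (Function.extend Subtype.val a 0) f ≠ 0}
  have hVo : IsOpen (V ∩ ψ ⁻¹' U) :=
    (h.continuousOn_param L).isOpen_inter_preimage (isOpen_param f free) hU
  have hne : (V ∩ ψ ⁻¹' U).Nonempty := by
    refine ⟨fun s => L x s, ?_, ?_⟩
    · change eval _ f ≠ 0
      rw [h.congr_eval _ _ fun _ => extend_apply]
      exact hf
    · change L.symm (Ψ (Function.extend Subtype.val (fun s : {s // free s} => L x s) 0)) ∈ U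
      rw [h.param_coords ((hL _).2 hx) hf]
      exact (L.symm_apply_apply x).symm ▸ hxU
  rw [← ZSpace.topologicalKrullDim_eq hVo hne]
  have hS : ∀ a ∈ V, ψ a ∈ S := fun a ha => (hL _).1 (by
    change L (L.symm _) ∈ S
    rw [L.apply_symm_apply]
    exact h.map_mem _ ha)
  let F : (V ∩ ψ ⁻¹' U : Set _) → T :=
    fun a => ⟨ψ a.1, hS a.1 a.2.1, a.2.2⟩
  have hF : Continuous F := Continuous.subtype_mk
    (continuousOn_iff_continuous_domRestrict.1
      ((h.continuousOn_param L).mono Set.inter_subset_left)) _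
  let G : T → ZSpace {s // free s} := fun y s => L y.1 s
  have hG : Continuous G := (continuous_coords free L).comp continuous_subtype_val
  refine IsInducing.topologicalKrullDim_le (IsInducing.of_comp hF hG ?_)
  have : G ∘ F = Subtype.val := by
    refine _root_.funext fun a => ?_
    change (fun s : {s // free s} =>
      L (L.symm (Ψ (Function.extend Subtype.val a.1 0))) s) = a.1
    rw [L.apply_symm_apply]
    exact h.coords_param a.2.1
  rw [this]
  exact IsInducing.subtypeVal

/-- The number of free coordinates is the dimension of `S`. -/
theorem zariskiDim_eq [Fintype σ] (h : GraphChart S f free Ψ)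
    (hL : ∀ x ∈ S, ∃ L : (σ → ℂ) ≃ₗ[ℂ] (σ → ℂ), (∀ y, L y ∈ S ↔ y ∈ S) ∧ eval (L x) f ≠ 0)
    (hS : S.Nonempty) : zariskiDim S = Nat.card {s // free s} := by
  refine le_antisymm ?_ ?_
  · let T : Set (ZSpace σ) := S
    change zariskiDim (σ := σ) T ≤ _
    rw [zariskiDim_eq_topologicalKrullDim]
    refine topologicalKrullDim_le_of_forall_exists_isOpen fun x => ?_
    obtain ⟨L, hLS, hLx⟩ := hL x.1 x.2
    obtain ⟨g, hg⟩ := exists_eval_eq_eval_linearMap (L : (σ → ℂ) →ₗ[ℂ] (σ → ℂ)) f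
    let U : Set (ZSpace σ) := {y | eval y g ≠ 0}
    have hU : IsOpen U := ZSpace.isOpen_ne g
    refine ⟨Subtype.val ⁻¹' U, hU.preimage continuous_subtype_val, ?_, ?_⟩
    · change eval x.1 g ≠ 0
      exact (hg x.1).symm ▸ hLx
    · let F : (Subtype.val ⁻¹' U : Set T) → (T ∩ U : Set (ZSpace σ)) :=
        fun z => ⟨z.1.1, z.1.2, z.2⟩
      have hF : IsInducing F :=
        IsInducing.of_comp (g := Subtype.val) (Continuous.subtype_mk
          (continuous_subtype_val.comp continuous_subtype_val) _) continuous_subtype_val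
          ((IsInducing.subtypeVal (t := fun z => z ∈ T)).comp
            (IsInducing.subtypeVal (t := fun z => z ∈ Subtype.val ⁻¹' U)))
      refine hF.topologicalKrullDim_le.trans
        (h.zariskiDim_le L hLS Set.inter_subset_left fun y hy => ?_)
      exact fun h0 => hy.2 ((hg y).trans h0)
  · obtain ⟨x, hx⟩ := hS
    obtain ⟨L, hLS, hLx⟩ := hL x hx
    have := h.le_zariskiDim L hLS hx hLx (isOpen_univ (X := ZSpace σ)) (Set.mem_univ _)
    exact (congrArg zariskiDim (Set.inter_univ S)) ▸ this

/-- The tangent dimension and the local dimension both equal the number of free coordinates. -/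
theorem isSmooth [Fintype σ] (h : GraphChart S f free Ψ)
    (hL : ∀ x ∈ S, ∃ L : (σ → ℂ) ≃ₗ[ℂ] (σ → ℂ), (∀ y, L y ∈ S ↔ y ∈ S) ∧ eval (L x) f ≠ 0)
    {x : σ → ℂ} (hx : x ∈ S) :
    ((Module.finrank ℂ (zariskiTangentSpace S x) : ℕ) : WithBot ℕ∞) = zariskiLocalDim S x := by
  obtain ⟨L, hLS, hLx⟩ := hL x hx
  rw [← finrank_zariskiTangentSpace_linearEquiv x L hLS,
    h.finrank_zariskiTangentSpace ((hLS x).2 hx) hLx]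
  refine le_antisymm (le_iInf fun U => h.le_zariskiDim L hLS hx hLx U.2.1 U.2.2) ?_
  refine (iInf_le _ ⟨Set.univ, isOpen_univ (X := ZSpace σ), Set.mem_univ x⟩).trans ?_
  rw [Set.inter_univ, h.zariskiDim_eq hL ⟨x, hx⟩]

end GraphChart

/-! ### Admissible strings and strings of ranks -/

section Strings

variable {n : ℕ}

lemma altSum_zero (a : Fin (n + 1) → ℤ) : altSum a 0 = a 0 := by
  have : Finset.Iic (0 : Fin (n + 1)) = {0} := by ext; simp
  simp [altSum, this]

lemma altSum_succ (a : Fin (n + 1) → ℤ) (i : Fin n) :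
    altSum a i.succ = a i.succ - altSum a i.castSucc := by
  have h : Finset.Iic i.succ = insert i.succ (Finset.Iic i.castSucc) := by
    ext j
    simp only [Finset.mem_Iic, Finset.mem_insert, Fin.le_def, Fin.ext_iff, Fin.val_succ,
      Fin.val_castSucc]
    omega
  have h' : i.succ ∉ Finset.Iic i.castSucc := by simp [Fin.le_def]
  rw [altSum, h, Finset.sum_insert h', altSum, sub_eq_add_neg, ← Finset.sum_neg_distrib]
  congr 1
  · rw [Even.neg_one_pow ⟨_, rfl⟩, one_mul]
  · refine Finset.sum_congr rfl fun j _ => ?_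
    rw [Fin.val_succ, Fin.val_castSucc, ← add_assoc, pow_succ]
    ring

lemma sum_eq_altSum_last (a : Fin (n + 1) → ℤ) :
    ∑ i : Fin (n + 1), (-1) ^ (i : ℕ) * a i = (-1) ^ n * altSum a (Fin.last n) := by
  have h : Finset.Iic (Fin.last n) = Finset.univ := by ext j; simp [Fin.le_last]
  rw [altSum, h, Finset.mul_sum]
  refine Finset.sum_congr rfl fun j _ => ?_
  rw [Fin.val_last, ← mul_assoc, ← pow_add, show n + ((j : ℕ) + n) = j + (n + n) by ring,
    pow_add _ (j : ℕ), Even.neg_one_pow ⟨_, rfl⟩, mul_one]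

lemma altSum_sub (a c : Fin (n + 1) → ℤ) (j : Fin (n + 1)) :
    altSum (fun i => a i - c i) j = altSum a j - altSum c j := by
  simp [altSum, mul_sub, Finset.sum_sub_distrib]

/-- `r` is the string of ranks of a complex with dimensions `k` and Betti numbers `b`: the
differential `d^i` has rank `r (i + 1)`, so that `r i` is the rank of the differential with
target `ℂ^{k_i}`. -/
structure IsRankString (k b : Fin (n + 1) → ℕ) (r : ℕ → ℕ) : Prop where
  zero : r 0 = 0
  last : r (n + 1) = 0
  eq : ∀ j (h : j < n + 1), k ⟨j, h⟩ = r j + b ⟨j, h⟩ + r (j + 1)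

lemma IsRankString.altSum_eq {k b : Fin (n + 1) → ℕ} {r : ℕ → ℕ} (hr : IsRankString k b r)
    (j : Fin (n + 1)) : altSum (fun i => (k i : ℤ) - b i) j = r (j + 1) := by
  induction j using Fin.induction with
  | zero =>
    have := hr.eq 0 (Nat.succ_pos n)
    have h0 := hr.zero
    rw [altSum_zero]
    simp only [Fin.mk_zero] at this
    simp only [Fin.val_zero]
    omega
  | succ i ih =>
    rw [altSum_succ, ih]
    have : k i.succ = r (i + 1) + b i.succ + r (i + 1 + 1) := hr.eq (i + 1) i.succ.2
    simp only [Fin.val_castSucc, Fin.val_succ]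
    omega

lemma admissible_iff {a : Fin (n + 1) → ℤ} :
    Admissible a ↔ altSum a (Fin.last n) = 0 ∧ ∀ i : Fin n, 0 ≤ altSum a i.castSucc := by
  rw [Admissible, sum_eq_altSum_last]
  simp

lemma IsRankString.dominates {k b : Fin (n + 1) → ℕ} {r : ℕ → ℕ} (hr : IsRankString k b r) :
    Dominates k b := by
  refine admissible_iff.2 ⟨?_, fun i => ?_⟩
  · rw [hr.altSum_eq, Fin.val_last, hr.last]
    rfl
  · rw [hr.altSum_eq]
    positivity

lemma Dominates.exists_isRankString {k b : Fin (n + 1) → ℕ} (h : Dominates k b) :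
    ∃ r, IsRankString k b r := by
  obtain ⟨h1, h2⟩ := admissible_iff.1 h
  have hnn : ∀ j : Fin (n + 1), 0 ≤ altSum (fun i => (k i : ℤ) - b i) j := fun j => by
    induction j using Fin.lastCases with
    | last => exact h1.ge
    | cast i => exact h2 i
  let r : ℕ → ℕ := fun j => match j with
    | 0 => 0
    | j + 1 => if h : j < n + 1 then (altSum (fun i => (k i : ℤ) - b i) ⟨j, h⟩).toNat else 0
  have hr : ∀ j (h : j < n + 1),
      (r (j + 1) : ℤ) = altSum (fun i => (k i : ℤ) - b i) ⟨j, h⟩ := fun j h => by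
    simp only [r, h, dif_pos]
    exact Int.toNat_of_nonneg (hnn _)
  refine ⟨r, rfl, ?_, fun j hj => ?_⟩
  · have := hr n (Nat.lt_succ_self n)
    rw [show (⟨n, Nat.lt_succ_self n⟩ : Fin (n + 1)) = Fin.last n from rfl, h1] at this
    exact_mod_cast this
  · cases j with
    | zero =>
      have h3 := hr 0 hj
      have h4 := altSum_zero (fun i => (k i : ℤ) - b i)
      have h5 : r 0 = 0 := rfl
      simp only [Fin.mk_zero] at h3 ⊢
      omega
    | succ j =>
      have h3 := hr (j + 1) hj
      have h4 := hr j (by omega)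
      have h5 := altSum_succ (fun i => (k i : ℤ) - b i) ⟨j, by omega⟩
      simp only [Fin.succ_mk, Fin.castSucc_mk] at h5
      omega

lemma IsRankString.dominates_iff {k b b' : Fin (n + 1) → ℕ} {r r' : ℕ → ℕ}
    (hr : IsRankString k b r) (hr' : IsRankString k b' r') :
    Dominates b' b ↔ ∀ i, i < n → r' (i + 1) ≤ r (i + 1) := by
  have h : ∀ j : Fin (n + 1), altSum (fun i => (b' i : ℤ) - b i) j = r (j + 1) - r' (j + 1) := by
    intro j
    rw [← hr.altSum_eq, ← hr'.altSum_eq, ← altSum_sub]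
    congr 1
    funext i
    ring
  rw [Dominates, admissible_iff]
  simp only [h, Fin.val_last, hr.last, hr'.last, sub_self, true_and, Fin.val_castSucc,
    sub_nonneg, Nat.cast_le]
  exact ⟨fun h i hi => h ⟨i, hi⟩, fun h i => h i i.2⟩

lemma Dominates.trans {k b' b : Fin (n + 1) → ℕ} (h : Dominates k b') (h' : Dominates b' b) :
    Dominates k b := by
  have hadd : ∀ j, altSum (fun i => (k i : ℤ) - b i) j =
      altSum (fun i => (k i : ℤ) - b' i) j + altSum (fun i => (b' i : ℤ) - b i) j := fun j => by
    simp only [altSum_sub]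
    ring
  rw [Dominates, admissible_iff] at h h' ⊢
  simp only [hadd]
  exact ⟨by rw [h.1, h'.1, add_zero], fun i => add_nonneg (h.2 i) (h'.2 i)⟩

end Strings

/-! ### Complexes as sequences of matrices -/

namespace CochainStrings

variable {n : ℕ} {k : Fin (n + 1) → ℕ}

/-- The matrix of `d^i`. The index `i` is a natural number, so that the sizes of consecutive
matrices match syntactically. -/
def dmat (x : Ambient k) (i : ℕ) (h : i < n) :
    Matrix (Fin (k ⟨i + 1, Nat.succ_lt_succ h⟩)) (Fin (k ⟨i, Nat.lt_succ_of_lt h⟩)) ℂ :=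
  Matrix.of fun p q => x ⟨⟨i, h⟩, (p, q)⟩

/-- The point of the affine space given by a sequence of matrices. -/
def ofMat (A : ∀ (i : ℕ) (h : i < n),
    Matrix (Fin (k ⟨i + 1, Nat.succ_lt_succ h⟩)) (Fin (k ⟨i, Nat.lt_succ_of_lt h⟩)) ℂ) :
    Ambient k :=
  fun s => A s.1 s.1.2 s.2.1 s.2.2

lemma dmat_ofMat (A : ∀ (i : ℕ) (h : i < n),
    Matrix (Fin (k ⟨i + 1, Nat.succ_lt_succ h⟩)) (Fin (k ⟨i, Nat.lt_succ_of_lt h⟩)) ℂ)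
    (i : ℕ) (h : i < n) : dmat (ofMat A) i h = A i h := rfl

lemma ext_dmat {x y : Ambient k} (h : ∀ i hi, dmat x i hi = dmat y i hi) : x = y := by
  funext ⟨i, p, q⟩
  exact congrFun (congrFun (h i i.2) p) q

lemma diff_apply (x : Ambient k) (i : ℕ) (h : i < n)
    (v : Fin (k ⟨i, Nat.lt_succ_of_lt h⟩) → ℂ) : diff x ⟨i, h⟩ v = (dmat x i h).mulVec v := by
  exact Matrix.toLin'_apply _ _

lemma finrank_range_diff (x : Ambient k) (i : ℕ) (h : i < n) :
    Module.finrank ℂ (LinearMap.range (diff x ⟨i, h⟩)) = (dmat x i h).rank := by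
  rw [diff, Matrix.toLin'_apply']
  rfl

lemma mem_complexes_iff {x : Ambient k} : x ∈ complexes k ↔
    ∀ i (h : i + 1 < n), dmat x (i + 1) h * dmat x i (Nat.lt_of_succ_lt h) = 0 := by
  refine forall₂_congr fun i h => ?_
  constructor
  · intro H
    refine Matrix.ext_of_mulVec_single fun q => ?_
    have := H (Pi.single q 1)
    rw [diff_apply x i] at this
    erw [diff_apply x (i + 1) h] at this
    rw [← Matrix.mulVec_mulVec, Matrix.zero_mulVec]
    exact this
  · intro H v
    rw [diff_apply x i]
    refine (diff_apply x (i + 1) h _).trans ?_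
    refine (Matrix.mulVec_mulVec v (dmat x (i + 1) h) (dmat x i (Nat.lt_of_succ_lt h))).trans ?_
    rw [H, Matrix.zero_mulVec]

/-- The string of ranks of a sequence of matrices. -/
noncomputable def ranks (x : Ambient k) : ℕ → ℕ
  | 0 => 0
  | i + 1 => if h : i < n then (dmat x i h).rank else 0

lemma ranks_succ (x : Ambient k) {i : ℕ} (h : i < n) : ranks x (i + 1) = (dmat x i h).rank := by
  simp [ranks, h]

lemma cocycles_castSucc (x : Ambient k) (i : Fin n) :
    cocycles x i.castSucc = LinearMap.ker (diff x i) := Fin.lastCases_castSucc ..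

lemma cocycles_last (x : Ambient k) : cocycles x (Fin.last n) = ⊤ := Fin.lastCases_last

lemma coboundaries_zero (x : Ambient k) : coboundaries x 0 = ⊥ := rfl

lemma finrank_coboundaries (x : Ambient k) (j : Fin (n + 1)) :
    Module.finrank ℂ (coboundaries x j) = ranks x j := by
  induction j using Fin.cases with
  | zero =>
    rw [coboundaries_zero, finrank_bot]
    rfl
  | succ i =>
    rw [Fin.val_succ, ranks_succ x i.2, ← finrank_range_diff]
    rfl

lemma finrank_cocycles (x : Ambient k) (j : Fin (n + 1)) :
    Module.finrank ℂ (cocycles x j) + ranks x (j + 1) = k j := by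
  induction j using Fin.lastCases with
  | last =>
    have h : ranks x (Fin.last n + 1) = 0 := by simp [ranks]
    rw [h, cocycles_last, finrank_top, Module.finrank_fin_fun, add_zero]
  | cast i =>
    have h := LinearMap.finrank_range_add_finrank_ker (diff x i)
    rw [Module.finrank_fin_fun] at h
    rw [Fin.val_castSucc, ranks_succ x i.2, ← finrank_range_diff, cocycles_castSucc, add_comm]
    exact h

lemma coboundaries_le_cocycles {x : Ambient k} (hx : x ∈ complexes k) (j : Fin (n + 1)) :
    coboundaries x j ≤ cocycles x j := by
  induction j using Fin.lastCases with
  | last => exact cocycles_last x ▸ le_top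
  | cast i =>
    rw [cocycles_castSucc]
    obtain ⟨i, hi⟩ := i
    cases i with
    | zero => exact (coboundaries_zero x).le.trans bot_le
    | succ i =>
      rintro _ ⟨v, rfl⟩
      exact hx i hi v

lemma isRankString_ranks {x : Ambient k} (hx : x ∈ complexes k) :
    IsRankString k (fun j => Module.finrank ℂ (cohomology x j)) (ranks x) := by
  refine ⟨rfl, by simp [ranks], fun j hj => ?_⟩
  have h1 := finrank_cocycles x ⟨j, hj⟩
  have h2 := finrank_coboundaries x ⟨j, hj⟩
  have h3 := Submodule.finrank_quotient_add_finrank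
    ((coboundaries x ⟨j, hj⟩).submoduleOf (cocycles x ⟨j, hj⟩))
  rw [(Submodule.submoduleOfEquivOfLe (coboundaries_le_cocycles hx ⟨j, hj⟩)).finrank_eq] at h3
  simp only [cohomology]
  simp only at h1 h2
  omega

lemma finrank_cohomology_eq_iff {b : Fin (n + 1) → ℕ} {r : ℕ → ℕ} (hr : IsRankString k b r)
    {x : Ambient k} (hx : x ∈ complexes k) :
    (∀ j, Module.finrank ℂ (cohomology x j) = b j) ↔
      ∀ i (h : i < n), (dmat x i h).rank = r (i + 1) := by
  have hx' := isRankString_ranks hx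
  constructor
  · intro h i hi
    have hb : (fun j => Module.finrank ℂ (cohomology x j)) = b := funext h
    rw [hb] at hx'
    have h1 := hx'.altSum_eq ⟨i, Nat.lt_succ_of_lt hi⟩
    rw [hr.altSum_eq] at h1
    rw [← ranks_succ x hi]
    exact_mod_cast h1.symm
  · intro h j
    have h1 := hx'.eq j j.2
    have h2 := hr.eq j j.2
    have hrk : ∀ i, i ≤ n + 1 → ranks x i = r i := by
      intro i hi
      cases i with
      | zero => exact hr.zero.symm
      | succ i =>
        rcases Nat.lt_or_ge i n with h' | h'
        · rw [ranks_succ x h', h]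
        · obtain rfl : i = n := by omega
          rw [hx'.last, hr.last]
    rw [hrk j j.2.le, hrk (j + 1) j.2] at h1
    simp only [Fin.eta] at h1 h2
    omega

/-- A stratum is described by the ranks of the differentials. -/
lemma mem_bettiComplexes_iff {b : Fin (n + 1) → ℕ} {r : ℕ → ℕ} (hr : IsRankString k b r)
    {x : Ambient k} : x ∈ bettiComplexes k b ↔
      x ∈ complexes k ∧ ∀ i (h : i < n), (dmat x i h).rank = r (i + 1) :=
  and_congr_right fun hx => finrank_cohomology_eq_iff hr hx

lemma dominates_of_mem_bettiComplexes {b : Fin (n + 1) → ℕ} {x : Ambient k}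
    (hx : x ∈ bettiComplexes k b) : Dominates k b := by
  have h := isRankString_ranks hx.1
  rw [funext hx.2] at h
  exact h.dominates

lemma acyclicComplexes_eq (k : Fin (n + 1) → ℕ) :
    acyclicComplexes k = bettiComplexes k 0 := by
  ext x
  refine and_congr_right fun hx => forall_congr' fun j => ?_
  have hle := coboundaries_le_cocycles hx j
  rw [Pi.zero_apply, Module.finrank_eq_zero_iff_of_free, Submodule.Quotient.subsingleton_iff,
    Submodule.submoduleOf_eq_top]
  exact ⟨fun h => h.ge, fun h => le_antisymm hle h⟩

end CochainStrings

/-! ### Normal form of a complex -/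

/-- A basis of `ℂ^m` adapted to a linear map `d`: it starts with a given independent family in the
kernel, continues inside the kernel, and ends with given vectors, in reverse order, whose images
form a basis of the range. -/
lemma exists_adapted_basis {m r b s : ℕ} {W : Type*} [AddCommGroup W] [Module ℂ W]
    (d : (Fin m → ℂ) →ₗ[ℂ] W) (hm : m = r + b + s)
    (hd : Module.finrank ℂ (LinearMap.range d) = s)
    {u : Fin r → Fin m → ℂ} (hu : LinearIndependent ℂ u) (hdu : ∀ p, d (u p) = 0)
    {w : Fin s → Fin m → ℂ} (hw : LinearIndependent ℂ fun p => d (w p)) :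
    ∃ v : Fin m → Fin m → ℂ, LinearIndependent ℂ v ∧
      (∀ (p : Fin r) (q : Fin m), (q : ℕ) = p → v q = u p) ∧
      (∀ (p : Fin s) (q : Fin m), (p : ℕ) + q + 1 = m → v q = w p) ∧
      ∀ q : Fin m, (q : ℕ) < r + b → d (v q) = 0 := by
  let Z := LinearMap.ker d
  have hZ : Module.finrank ℂ Z = r + b := by
    have := LinearMap.finrank_range_add_finrank_ker d
    rw [Module.finrank_fin_fun] at this
    change Module.finrank ℂ (LinearMap.ker d) = _
    omega
  let u' : Fin r → Z := fun p => ⟨u p, hdu p⟩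
  have hu' : LinearIndependent ℂ u' := LinearIndependent.of_comp Z.subtype hu
  have hB : b ≤ Module.finrank ℂ (Z ⧸ Submodule.span ℂ (Set.range u')) := by
    have h1 := Submodule.finrank_quotient_add_finrank (Submodule.span ℂ (Set.range u'))
    have h2 := finrank_span_eq_card hu'
    rw [Fintype.card_fin] at h2
    omega
  obtain ⟨c, hc⟩ := exists_linearIndependent_of_le_finrank hB
  choose c' hc' using fun p => Submodule.Quotient.mk_surjective _ (c p)
  have h1 := LinearIndependent.sumElim_of_quotient
    (f := fun p => (⟨u' p, Submodule.subset_span ⟨p, rfl⟩⟩ : Submodule.span ℂ (Set.range u')))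
    (LinearIndependent.of_comp (Submodule.subtype _) hu') c' (by
      convert! hc using 1
      exact funext hc')
  have h2 : LinearIndependent ℂ (Submodule.Quotient.mk (p := Z) ∘ w) :=
    LinearIndependent.of_comp (Z.liftQ d le_rfl) hw
  have h3 := LinearIndependent.sumElim_of_quotient h1 w h2
  let e : Fin m → (Fin r ⊕ Fin b) ⊕ Fin s := fun q =>
    if h : (q : ℕ) < r then Sum.inl (Sum.inl ⟨q, h⟩)
    else if h' : (q : ℕ) < r + b then Sum.inl (Sum.inr ⟨q - r, by omega⟩)
    else Sum.inr ⟨m - 1 - q, by omega⟩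
  have he : Function.Injective e := by
    intro q q' h
    have := q.2
    have := q'.2
    simp only [e] at h
    refine Fin.ext ?_
    split_ifs at h <;> simp at h <;> omega
  refine ⟨_, h3.comp e he, fun p q hpq => ?_, fun p q hpq => ?_, fun q hq => ?_⟩
  · have : (q : ℕ) < r := hpq ▸ p.2
    have hp : (⟨q, this⟩ : Fin r) = p := Fin.ext hpq
    simp [e, this, hp, u']
  · have := p.2
    have h1 : ¬ (q : ℕ) < r := by omega
    have h2 : ¬ (q : ℕ) < r + b := by omega
    have hp : (⟨m - 1 - q, by omega⟩ : Fin s) = p := Fin.ext (by simp; omega)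
    simp [e, h1, h2, hp]
  · simp only [Function.comp, e]
    split_ifs with h
    · exact hdu _
    · exact (c' _).2

/-- A matrix of rank `s` maps some `s` vectors to linearly independent vectors. -/
lemma Matrix.exists_linearIndependent_mulVec {m l s : ℕ} (A : Matrix (Fin m) (Fin l) ℂ)
    (h : s ≤ A.rank) : ∃ w : Fin s → Fin l → ℂ, LinearIndependent ℂ fun p => A.mulVec (w p) := by
  obtain ⟨f, hf⟩ := exists_linearIndependent_of_le_finrank (R := ℂ)
    (M := LinearMap.range A.mulVecLin) h
  choose w hw using fun p => (f p).2
  refine ⟨w, ?_⟩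
  have h := hf.map' (Submodule.subtype _) (Submodule.ker_subtype _)
  convert! h using 1
  exact funext hw

namespace CochainStrings

variable {n : ℕ} {k : Fin (n + 1) → ℕ}

/-- The complex in which `d^i` sends the `(p + 1)`-st vector from the end of the standard basis of
`ℂ^{k_i}` to `w i p` times the `p`-th vector of the standard basis of `ℂ^{k_{i+1}}`. With this
choice, weights vanishing for `p ≥ r (i + 1)` give a complex as soon as consecutive ranks add up to
at most the dimension, and complexes for different `r` are obtained from each other by changing
weights only. -/
def standardComplex (k : Fin (n + 1) → ℕ) (w : ℕ → ℕ → ℂ) : Ambient k :=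
  ofMat fun i h => Matrix.of fun p q =>
    if (p : ℕ) + q + 1 = k ⟨i, Nat.lt_succ_of_lt h⟩ then w i p else 0

lemma dmat_standardComplex (w : ℕ → ℕ → ℂ) (i : ℕ) (h : i < n)
    (p : Fin (k ⟨i + 1, Nat.succ_lt_succ h⟩)) (q : Fin (k ⟨i, Nat.lt_succ_of_lt h⟩)) :
    dmat (standardComplex k w) i h p q =
      if (p : ℕ) + q + 1 = k ⟨i, Nat.lt_succ_of_lt h⟩ then w i p else 0 := rfl

lemma standardComplex_mem_bettiComplexes {b : Fin (n + 1) → ℕ} {r : ℕ → ℕ}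
    (hr : IsRankString k b r) {w : ℕ → ℕ → ℂ} (hw : ∀ i p, w i p ≠ 0 ↔ p < r (i + 1)) :
    standardComplex k w ∈ bettiComplexes k b := by
  refine (mem_bettiComplexes_iff hr).2 ⟨mem_complexes_iff.2 fun i h => ?_, fun i h => ?_⟩
  · ext p q
    rw [Matrix.mul_apply, Matrix.zero_apply]
    refine Finset.sum_eq_zero fun s _ => ?_
    rw [dmat_standardComplex, dmat_standardComplex]
    split_ifs with h1 h2
    · by_contra hne
      have hp := (hw _ _).1 (left_ne_zero_of_mul hne)
      have hs := (hw _ _).1 (right_ne_zero_of_mul hne)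
      have := hr.eq (i + 1) (by omega)
      omega
    all_goals simp
  · have h1 := hr.eq i (by omega)
    have h2 := hr.eq (i + 1) (by omega)
    let row : Fin (r (i + 1)) → Fin (k ⟨i + 1, Nat.succ_lt_succ h⟩) :=
      Fin.castLE (by omega)
    let col : Fin (r (i + 1)) → Fin (k ⟨i, Nat.lt_succ_of_lt h⟩) := fun p =>
      ⟨k ⟨i, Nat.lt_succ_of_lt h⟩ - 1 - p, by have := p.2; omega⟩
    refine le_antisymm ?_ ?_
    · have hfac : dmat (standardComplex k w) i h =
          (Matrix.of fun p s => if (p : ℕ) = s then 1 else 0 :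
            Matrix (Fin (k ⟨i + 1, Nat.succ_lt_succ h⟩)) (Fin (r (i + 1))) ℂ) * (dmat (standardComplex k w) i h).submatrix row id := by
        ext p q
        rw [Matrix.mul_apply]
        simp only [Matrix.of_apply, ite_mul, one_mul, zero_mul, Matrix.submatrix_apply, id]
        by_cases hp : (p : ℕ) < r (i + 1)
        · rw [Finset.sum_eq_single ⟨p, hp⟩]
          · simp [row]
          · intro s _ hs
            exact if_neg fun h => hs (Fin.ext h.symm)
          · simp
        · rw [Finset.sum_eq_zero, dmat_standardComplex]
          · have : w i p = 0 := not_not.1 (mt (hw i p).1 hp)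
            simp [this]
          · intro s _
            exact if_neg fun hps => hp (hps.trans_lt s.2)
      rw [hfac]
      exact (Matrix.rank_mul_le_left _ _).trans (Matrix.rank_le_width _)
    · have hdiag : (dmat (standardComplex k w) i h).submatrix row col =
          Matrix.diagonal fun p : Fin (r (i + 1)) => w i p := by
        ext p q
        have hp := p.2
        have hq := q.2
        rw [Matrix.submatrix_apply, dmat_standardComplex, Matrix.diagonal_apply]
        refine if_congr ?_ rfl rfl
        rw [Fin.ext_iff]
        simp only [row, col, Fin.val_castLE]
        omega
      have := Matrix.rank_submatrix_le (dmat (standardComplex k w) i h) row col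
      rw [hdiag, Matrix.rank_of_det_ne_zero (by
        rw [Matrix.det_diagonal]
        exact Finset.prod_ne_zero_iff.2 fun p _ => (hw i p).2 p.2), Fintype.card_fin] at this
      exact this

/-- The standard complex with ranks `r`. -/
def rankComplex (k : Fin (n + 1) → ℕ) (r : ℕ → ℕ) : Ambient k :=
  standardComplex k fun i p => if p < r (i + 1) then 1 else 0

lemma rankComplex_mem {b : Fin (n + 1) → ℕ} {r : ℕ → ℕ} (hr : IsRankString k b r) :
    rankComplex k r ∈ bettiComplexes k b :=
  standardComplex_mem_bettiComplexes hr fun i p => by simp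

/-- Base change in a sequence of matrices: `g` acts on the targets and `g'` on the sources. -/
def conj (g g' : ∀ j, Matrix (Fin (k j)) (Fin (k j)) ℂ) : Ambient k →ₗ[ℂ] Ambient k where
  toFun x := ofMat fun i h => g ⟨i + 1, Nat.succ_lt_succ h⟩ * dmat x i h *
    g' ⟨i, Nat.lt_succ_of_lt h⟩
  map_add' x y := ext_dmat fun i h => by
    have h1 : ∀ x y : Ambient k, dmat (x + y) i h = dmat x i h + dmat y i h := fun _ _ => rfl
    rw [h1]
    simp only [dmat_ofMat, h1]
    rw [Matrix.mul_add, Matrix.add_mul]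
  map_smul' c x := ext_dmat fun i h => by
    have h1 : ∀ x : Ambient k, dmat (c • x) i h = c • dmat x i h := fun _ => rfl
    rw [RingHom.id_apply, h1]
    simp only [dmat_ofMat, h1]
    rw [Matrix.mul_smul, Matrix.smul_mul]

lemma dmat_conj (g g' : ∀ j, Matrix (Fin (k j)) (Fin (k j)) ℂ) (x : Ambient k) (i : ℕ)
    (h : i < n) : dmat (conj g g' x) i h = g ⟨i + 1, Nat.succ_lt_succ h⟩ * dmat x i h *
      g' ⟨i, Nat.lt_succ_of_lt h⟩ := rfl

lemma conj_conj {g g' : ∀ j, Matrix (Fin (k j)) (Fin (k j)) ℂ} (h : ∀ j, g j * g' j = 1)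
    (x : Ambient k) : conj g g' (conj g' g x) = x := by
  refine ext_dmat fun i hi => ?_
  rw [dmat_conj, dmat_conj]
  rw [Matrix.mul_assoc, Matrix.mul_assoc, h, ← Matrix.mul_assoc, ← Matrix.mul_assoc, h,
    Matrix.one_mul, Matrix.mul_one]

lemma conj_mem {b : Fin (n + 1) → ℕ} {g g' : ∀ j, Matrix (Fin (k j)) (Fin (k j)) ℂ}
    (h : ∀ j, g j * g' j = 1) {x : Ambient k} (hx : x ∈ bettiComplexes k b) :
    conj g g' x ∈ bettiComplexes k b := by
  have h' : ∀ j, g' j * g j = 1 := fun j => mul_eq_one_comm.1 (h j)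
  obtain ⟨r, hr⟩ := (dominates_of_mem_bettiComplexes hx).exists_isRankString
  rw [mem_bettiComplexes_iff hr, mem_complexes_iff] at hx ⊢
  refine ⟨fun i hi => ?_, fun i hi => ?_⟩
  · rw [dmat_conj, dmat_conj]
    calc _ = g ⟨i + 1 + 1, _⟩ * (dmat x (i + 1) hi *
          ((g' ⟨i + 1, _⟩ * g ⟨i + 1, _⟩) * dmat x i (Nat.lt_of_succ_lt hi))) *
          g' ⟨i, _⟩ := by simp only [Matrix.mul_assoc]
      _ = 0 := by
        rw [h', Matrix.one_mul, hx.1 i hi, Matrix.mul_zero, Matrix.zero_mul]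
  · rw [dmat_conj,
      Matrix.rank_mul_eq_left_of_det_ne_zero _ _ (Matrix.det_ne_zero_of_right_inverse (h' _)),
      Matrix.rank_mul_eq_right_of_det_ne_zero _ _ (Matrix.det_ne_zero_of_right_inverse (h _)),
      hx.2 i hi]

/-- Base change by invertible matrices is a linear symmetry of every stratum. -/
def conjEquiv (g g' : ∀ j, Matrix (Fin (k j)) (Fin (k j)) ℂ) (h : ∀ j, g j * g' j = 1) :
    Ambient k ≃ₗ[ℂ] Ambient k :=
  LinearEquiv.ofLinearMap (conj g g') (conj g' g) (LinearMap.ext fun x => conj_conj h x)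
    (LinearMap.ext fun x => conj_conj (fun j => mul_eq_one_comm.1 (h j)) x)

lemma conjEquiv_mem_iff {b : Fin (n + 1) → ℕ} {g g' : ∀ j, Matrix (Fin (k j)) (Fin (k j)) ℂ}
    (h : ∀ j, g j * g' j = 1) (x : Ambient k) :
    conjEquiv g g' h x ∈ bettiComplexes k b ↔ x ∈ bettiComplexes k b := by
  refine ⟨fun hx => ?_, fun hx => conj_mem h hx⟩
  have h' : ∀ j, g' j * g j = 1 := fun j => mul_eq_one_comm.1 (h j)
  have := conj_mem h' hx
  change conj g' g (conj g g' x) ∈ _ at this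
  rwa [conj_conj h'] at this

/-- Every complex is, after a change of bases, the standard complex with the same ranks. -/
theorem exists_conj_rankComplex {b : Fin (n + 1) → ℕ} {r : ℕ → ℕ} (hr : IsRankString k b r)
    {x : Ambient k} (hx : x ∈ bettiComplexes k b) :
    ∃ g g' : ∀ j, Matrix (Fin (k j)) (Fin (k j)) ℂ,
      (∀ j, g j * g' j = 1) ∧ x = conj g g' (rankComplex k r) := by
  rw [mem_bettiComplexes_iff hr, mem_complexes_iff] at hx
  obtain ⟨hx, hrk⟩ := hx
  -- `d^j` maps the vectors `w j` to a basis of its range; for `j = n` there are no such vectors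
  have hw : ∀ j (hj : j < n + 1), ∃ w : Fin (r (j + 1)) → Fin (k ⟨j, hj⟩) → ℂ,
      ∀ h : j < n, LinearIndependent ℂ fun p => (dmat x j h).mulVec (w p) := by
    intro j hj
    by_cases h : j < n
    · obtain ⟨w, hw⟩ := (dmat x j h).exists_linearIndependent_mulVec (hrk j h).ge
      exact ⟨w, fun _ => hw⟩
    · exact ⟨fun _ _ => 0, fun h' => absurd h' h⟩
  choose w hw using hw
  -- `u j` is the basis `d^{j-1} (w (j-1))` of the image of the incoming differential
  let u : ∀ j (hj : j < n + 1), Fin (r j) → Fin (k ⟨j, hj⟩) → ℂ := fun j hj =>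
    match j, hj with
    | 0, _ => 0
    | j + 1, hj => fun p => (dmat x j (Nat.lt_of_succ_lt_succ hj)).mulVec
        (w j (Nat.lt_of_succ_lt hj) p)
  have hu1 : ∀ j hj, LinearIndependent ℂ (u j hj) := by
    intro j hj
    cases j with
    | zero =>
      have : IsEmpty (Fin (r 0)) := by rw [hr.zero]; infer_instance
      exact linearIndependent_empty_type
    | succ j => exact hw j _ _
  have hu2 : ∀ j hj (h : j < n) p, (dmat x j h).mulVec (u j hj p) = 0 := by
    intro j hj h p
    cases j with
    | zero => exact Matrix.mulVec_zero _
    | succ j =>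
      refine (Matrix.mulVec_mulVec (w j (Nat.lt_of_succ_lt hj) p) (dmat x (j + 1) h)
        (dmat x j (Nat.lt_of_succ_lt_succ hj))).trans ?_
      rw [hx j h, Matrix.zero_mulVec]
  have hv : ∀ j (hj : j < n + 1), ∃ v : Fin (k ⟨j, hj⟩) → Fin (k ⟨j, hj⟩) → ℂ,
      LinearIndependent ℂ v ∧ (∀ (p : Fin (r j)) (q : Fin _), (q : ℕ) = p → v q = u j hj p) ∧
      (∀ (p : Fin (r (j + 1))) (q : Fin _), (p : ℕ) + q + 1 = k ⟨j, hj⟩ → v q = w j hj p) ∧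
      ∀ q : Fin _, (q : ℕ) < r j + b ⟨j, hj⟩ → ∀ h : j < n, (dmat x j h).mulVec (v q) = 0 := by
    intro j hj
    by_cases h : j < n
    · obtain ⟨v, h1, h2, h3, h4⟩ := exists_adapted_basis (dmat x j h).mulVecLin (hr.eq j hj)
        (hrk j h) (hu1 j hj) (hu2 j hj h) (hw j hj h)
      exact ⟨v, h1, h2, h3, fun q hq _ => h4 q hq⟩
    · have hjn : j = n := by omega
      have h0 : r (j + 1) = 0 := by rw [hjn, hr.last]
      have : IsEmpty (Fin (r (j + 1))) := by rw [h0]; infer_instance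
      obtain ⟨v, h1, h2, h3, h4⟩ := exists_adapted_basis
        (0 : (Fin (k ⟨j, hj⟩) → ℂ) →ₗ[ℂ] ℂ) (hr.eq j hj)
        (by rw [LinearMap.range_zero, finrank_bot, h0]) (hu1 j hj) (fun _ => rfl)
        (w := w j hj) linearIndependent_empty_type
      exact ⟨v, h1, h2, h3, fun q hq h' => absurd h' h⟩
  choose v hv1 hv2 hv3 hv4 using hv
  -- the columns of `g j` are the adapted basis of `ℂ^{k_j}`
  let g : ∀ j : Fin (n + 1), Matrix (Fin (k j)) (Fin (k j)) ℂ :=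
    fun j => Matrix.of fun a q => v j j.2 q a
  have hg : ∀ j, g j * (g j)⁻¹ = 1 := by
    intro j
    refine Matrix.mul_nonsing_inv _ ((Matrix.isUnit_iff_isUnit_det _).1 ?_)
    exact Matrix.linearIndependent_cols_iff_isUnit.1 (hv1 j j.2)
  refine ⟨g, fun j => (g j)⁻¹, hg, ext_dmat fun i h => ?_⟩
  have hcomm : dmat x i h * g ⟨i, Nat.lt_succ_of_lt h⟩ =
      g ⟨i + 1, Nat.succ_lt_succ h⟩ * dmat (rankComplex k r) i h := by
    ext a q
    have hL : (dmat x i h * g ⟨i, Nat.lt_succ_of_lt h⟩) a q =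
        (dmat x i h).mulVec (v i (Nat.lt_succ_of_lt h) q) a := rfl
    rw [hL, Matrix.mul_apply]
    have hk := hr.eq i (by omega)
    have hk' := hr.eq (i + 1) (by omega)
    have hq2 := q.2
    by_cases hq : (q : ℕ) < r i + b ⟨i, by omega⟩
    · rw [hv4 _ _ _ hq h, Pi.zero_apply, Finset.sum_eq_zero]
      intro p _
      rw [rankComplex, dmat_standardComplex, mul_eq_zero]
      right
      split_ifs <;> first | rfl | omega
    · let p : Fin (r (i + 1)) := ⟨k ⟨i, Nat.lt_succ_of_lt h⟩ - 1 - q, by omega⟩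
      rw [Finset.sum_eq_single ⟨p, by have := p.2; omega⟩]
      · rw [hv3 _ _ p q (by simp only [p]; omega), rankComplex, dmat_standardComplex,
          if_pos (by simp only [p]; omega), if_pos p.2, mul_one]
        change _ = v (i + 1) _ _ a
        rw [hv2 (i + 1) _ p _ rfl]
      · intro s _ hs
        rw [rankComplex, dmat_standardComplex, if_neg, mul_zero]
        intro h1
        exact hs (Fin.ext (by simp only [p]; omega))
      · simp
  rw [dmat_conj, ← hcomm, Matrix.mul_assoc, hg, Matrix.mul_one]

end CochainStrings

/-! ### A rational chart of a stratum -/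

/-- A matrix of rank at most `s` with an invertible `s × s` submatrix is the product of the columns and the
rows of that submatrix, normalised by its inverse. -/
lemma Matrix.eq_mul_inv_mul_of_rank_le {m l s : ℕ} (A : Matrix (Fin m) (Fin l) ℂ)
    (row : Fin s → Fin m) (col : Fin s → Fin l) (hdet : (A.submatrix row col).det ≠ 0)
    (hA : A.rank ≤ s) :
    A = A.submatrix id col * (A.submatrix row col)⁻¹ * A.submatrix row id := by
  have hle : LinearMap.range (A.submatrix id col).mulVecLin ≤ LinearMap.range A.mulVecLin := by
    rw [Matrix.range_mulVecLin, Matrix.range_mulVecLin]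
    refine Submodule.span_mono ?_
    rintro _ ⟨c, rfl⟩
    exact ⟨col c, rfl⟩
  have hrk : s ≤ (A.submatrix id col).rank := by
    have h := Matrix.rank_submatrix_le (A.submatrix id col) row id
    rw [Matrix.submatrix_submatrix, Function.id_comp, Function.comp_id,
      Matrix.rank_of_det_ne_zero hdet, Fintype.card_fin] at h
    exact h
  have heq := Submodule.eq_of_le_of_finrank_le hle (hA.trans hrk)
  have hcol : ∀ q, ∃ v, (A.submatrix id col).mulVec v = A.col q := by
    intro q
    have : A.col q ∈ LinearMap.range (A.submatrix id col).mulVecLin := by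
      rw [heq, Matrix.range_mulVecLin]
      exact Submodule.subset_span ⟨q, rfl⟩
    exact this
  choose v hv using hcol
  have hX : A = A.submatrix id col * Matrix.of fun c q => v q c := by
    ext p q
    exact (congrFun (hv q) p).symm
  have hR : A.submatrix row id = A.submatrix row col * Matrix.of fun c q => v q c := by
    ext p q
    exact (congrFun (hv q) (row p)).symm
  rw [hR, Matrix.mul_assoc, ← Matrix.mul_assoc _ (A.submatrix row col),
    Matrix.nonsing_inv_mul _ (isUnit_iff_ne_zero.2 hdet), Matrix.one_mul, ← hX]

/-- The entries of the inverse of a matrix of polynomials are regular where a multiple of the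
determinant does not vanish. -/
lemma RegularOff.inv_apply {σ : Type} {f : MvPolynomial σ ℂ} {m : ℕ}
    {M : Matrix (Fin m) (Fin m) (MvPolynomial σ ℂ)} (hM : M.det ∣ f) (p q : Fin m) :
    RegularOff f fun x => ((eval x).mapMatrix M)⁻¹ p q := by
  refine RegularOff.of_dvd _ (M.adjugate p q) hM fun x hx => ?_
  have hadj : eval x (M.adjugate p q) = ((eval x).mapMatrix M).adjugate p q :=
    congrFun (congrFun (RingHom.map_adjugate (eval x) M) p) q
  have hdet : ((eval x).mapMatrix M).det ≠ 0 := by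
    rw [← RingHom.map_det]
    exact fun h => hx (zero_dvd_iff.1 (h ▸ map_dvd (eval x) hM))
  rw [hadj, RingHom.map_det, Matrix.inv_def, Matrix.smul_apply, smul_eq_mul, ← mul_assoc,
    Ring.mul_inverse_cancel _ (isUnit_iff_ne_zero.2 hdet), one_mul]

namespace CochainStrings

variable {n : ℕ} {k b : Fin (n + 1) → ℕ} {r : ℕ → ℕ}

/-- The first `r (i + 1)` rows of `d^i`. -/
def topRow (hr : IsRankString k b r) (i : ℕ) (h : i < n) (p : Fin (r (i + 1))) :
    Fin (k ⟨i + 1, Nat.succ_lt_succ h⟩) :=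
  ⟨p, by have := hr.eq (i + 1) (Nat.succ_lt_succ h); have := p.2; omega⟩

/-- The last `r (i + 1)` columns of `d^i`. -/
def endCol (hr : IsRankString k b r) (i : ℕ) (h : i < n) (c : Fin (r (i + 1))) :
    Fin (k ⟨i, Nat.lt_succ_of_lt h⟩) :=
  ⟨r i + b ⟨i, Nat.lt_succ_of_lt h⟩ + c, by
    have := hr.eq i (Nat.lt_succ_of_lt h); have := c.2; omega⟩

/-- The top right square block of `d^i`, of size `r (i + 1)`. -/
def pivot (hr : IsRankString k b r) (x : Ambient k) (i : ℕ) (h : i < n) :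
    Matrix (Fin (r (i + 1))) (Fin (r (i + 1))) ℂ :=
  (dmat x i h).submatrix (topRow hr i h) (endCol hr i h)

/-- The pivot block with polynomial entries. -/
noncomputable def pivotPoly (hr : IsRankString k b r) (i : ℕ) (h : i < n) :
    Matrix (Fin (r (i + 1))) (Fin (r (i + 1))) (MvPolynomial (Coord k) ℂ) :=
  Matrix.of fun p c => X ⟨⟨i, h⟩, (topRow hr i h p, endCol hr i h c)⟩

lemma map_pivotPoly (hr : IsRankString k b r) (x : Ambient k) (i : ℕ) (h : i < n) :
    (eval x).mapMatrix (pivotPoly hr i h) = pivot hr x i h := by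
  ext p c
  simp [pivotPoly, pivot, dmat]

lemma eval_det_pivotPoly (hr : IsRankString k b r) (x : Ambient k) (i : ℕ) (h : i < n) :
    eval x (pivotPoly hr i h).det = (pivot hr x i h).det := by
  rw [RingHom.map_det, map_pivotPoly]

/-- The product of the determinants of the pivot blocks, whose non-vanishing is the domain of the
chart. -/
noncomputable def pivotProd (hr : IsRankString k b r) : MvPolynomial (Coord k) ℂ :=
  ∏ i : Fin n, (pivotPoly hr i i.2).det

lemma det_pivotPoly_dvd (hr : IsRankString k b r) (i : Fin n) :
    (pivotPoly hr i i.2).det ∣ pivotProd hr := by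
  rw [pivotProd]
  exact Finset.dvd_prod_of_mem (fun i : Fin n => (pivotPoly hr i i.2).det) (Finset.mem_univ i)

lemma eval_pivotProd (hr : IsRankString k b r) (x : Ambient k) :
    eval x (pivotProd hr) = ∏ i : Fin n, (pivot hr x i i.2).det := by
  rw [pivotProd, map_prod]
  exact Finset.prod_congr rfl fun i _ => eval_det_pivotPoly hr x i i.2

lemma det_pivot_ne_zero (hr : IsRankString k b r) {x : Ambient k}
    (hx : eval x (pivotProd hr) ≠ 0) (i : ℕ) (h : i < n) : (pivot hr x i h).det ≠ 0 := by
  rw [eval_pivotProd] at hx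
  exact Finset.prod_ne_zero_iff.1 hx ⟨i, h⟩ (Finset.mem_univ _)

/-- The basis of the image of the incoming differential at `ℂ^{k_j}` whose first `r j` rows form
the identity matrix. -/
noncomputable def imageMat (hr : IsRankString k b r) (x : Ambient k) :
    ∀ j (hj : j < n + 1), Matrix (Fin (k ⟨j, hj⟩)) (Fin (r j)) ℂ
  | 0, _ => 0
  | i + 1, hj => (dmat x i (Nat.lt_of_succ_lt_succ hj)).submatrix id
      (endCol hr i (Nat.lt_of_succ_lt_succ hj)) * (pivot hr x i (Nat.lt_of_succ_lt_succ hj))⁻¹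

/-- The first `r (i + 1)` rows of `d^i`, where the first `r i` columns are recomputed from the
others so that the matrix annihilates the image of the incoming differential. -/
noncomputable def rowMat (hr : IsRankString k b r) (x : Ambient k) (i : ℕ) (h : i < n) :
    Matrix (Fin (r (i + 1))) (Fin (k ⟨i, Nat.lt_succ_of_lt h⟩)) ℂ :=
  Matrix.of fun p q =>
    if hq : (q : ℕ) < r i then
      -∑ s ∈ Finset.univ.filter fun s : Fin (k ⟨i, Nat.lt_succ_of_lt h⟩) => r i ≤ (s : ℕ),
        dmat x i h (topRow hr i h p) s * imageMat hr x i (Nat.lt_succ_of_lt h) s ⟨q, hq⟩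
    else dmat x i h (topRow hr i h p) q

/-- The rational retraction onto the stratum. -/
noncomputable def retraction (hr : IsRankString k b r) (x : Ambient k) : Ambient k :=
  ofMat fun i h => imageMat hr x (i + 1) (Nat.succ_lt_succ h) * rowMat hr x i h

lemma dmat_retraction (hr : IsRankString k b r) (x : Ambient k) (i : ℕ) (h : i < n) :
    dmat (retraction hr x) i h =
      imageMat hr x (i + 1) (Nat.succ_lt_succ h) * rowMat hr x i h := rfl

lemma imageMat_succ (hr : IsRankString k b r) (x : Ambient k) (i : ℕ) (h : i < n) :
    imageMat hr x (i + 1) (Nat.succ_lt_succ h) =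
      (dmat x i h).submatrix id (endCol hr i h) * (pivot hr x i h)⁻¹ := rfl

/-- The coordinates that parametrise the stratum: the entries of the last `r (i + 1)` columns of
`d^i`, and the entries of the first `r (i + 1)` rows in the `b i` columns preceding them. -/
def IsFreeCoord (b : Fin (n + 1) → ℕ) (r : ℕ → ℕ) (s : Coord k) : Prop :=
  r s.1 + b s.1.castSucc ≤ s.2.2 ∨ (r s.1 ≤ s.2.2 ∧ (s.2.1 : ℕ) < r (s.1 + 1))

lemma imageMat_top (hr : IsRankString k b r) {x : Ambient k} (hx : eval x (pivotProd hr) ≠ 0)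
    (i : ℕ) (h : i < n) :
    (imageMat hr x (i + 1) (Nat.succ_lt_succ h)).submatrix (topRow hr i h) id = 1 :=
  Matrix.mul_nonsing_inv _ (isUnit_iff_ne_zero.2 (det_pivot_ne_zero hr hx i h))

lemma imageMat_apply_of_lt (hr : IsRankString k b r) {x : Ambient k}
    (hx : eval x (pivotProd hr) ≠ 0) (j : ℕ) (hj : j < n + 1) (s : Fin (k ⟨j, hj⟩))
    (c : Fin (r j)) (hs : (s : ℕ) < r j) :
    imageMat hr x j hj s c = if (s : ℕ) = c then 1 else 0 := by
  cases j with
  | zero => rw [hr.zero] at hs; omega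
  | succ i =>
    have h := congrFun (congrFun (imageMat_top hr hx i (Nat.lt_of_succ_lt_succ hj)) ⟨s, hs⟩) c
    rw [Matrix.one_apply] at h
    exact h.trans (if_congr Fin.ext_iff rfl rfl)

lemma rowMat_apply_of_le (hr : IsRankString k b r) (x : Ambient k) (i : ℕ) (h : i < n)
    (p : Fin (r (i + 1))) (q : Fin (k ⟨i, Nat.lt_succ_of_lt h⟩)) (hq : r i ≤ (q : ℕ)) :
    rowMat hr x i h p q = dmat x i h (topRow hr i h p) q :=
  dif_neg (not_lt.2 hq)

/-- By the choice of the first `r i` columns of `rowMat`: the first `r i` rows of `imageMat` form the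
identity matrix. -/
lemma rowMat_mul_imageMat (hr : IsRankString k b r) {x : Ambient k}
    (hx : eval x (pivotProd hr) ≠ 0) (i : ℕ) (h : i < n) :
    rowMat hr x i h * imageMat hr x i (Nat.lt_succ_of_lt h) = 0 := by
  ext p c
  have hc : (c : ℕ) < k ⟨i, Nat.lt_succ_of_lt h⟩ := by
    have := hr.eq i (Nat.lt_succ_of_lt h)
    have := c.2
    omega
  rw [Matrix.mul_apply, Matrix.zero_apply, ← Finset.sum_filter_add_sum_filter_not _
    (fun s : Fin (k ⟨i, Nat.lt_succ_of_lt h⟩) => r i ≤ (s : ℕ)), add_comm,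
    Finset.sum_eq_single (⟨c, hc⟩ : Fin (k ⟨i, Nat.lt_succ_of_lt h⟩))]
  · rw [imageMat_apply_of_lt hr hx _ _ _ _ c.2, if_pos rfl, mul_one, rowMat, Matrix.of_apply,
      dif_pos c.2, neg_add_eq_zero]
    refine Finset.sum_congr rfl fun s hs => ?_
    exact congrArg (· * _) (rowMat_apply_of_le hr x i h p s (Finset.mem_filter.1 hs).2).symm
  · intro s hs hsc
    rw [imageMat_apply_of_lt hr hx _ _ _ _ (not_le.1 (Finset.mem_filter.1 hs).2), if_neg, mul_zero]
    exact fun h => hsc (Fin.ext h)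
  · intro hmem
    exact (hmem (by simp)).elim

lemma retraction_apply_of_isFreeCoord (hr : IsRankString k b r) {x : Ambient k}
    (hx : eval x (pivotProd hr) ≠ 0) (s : Coord k) (hs : IsFreeCoord b r s) :
    retraction hr x s = x s := by
  obtain ⟨⟨i, h⟩, p, q⟩ := s
  change (imageMat hr x (i + 1) (Nat.succ_lt_succ h) * rowMat hr x i h) p q = dmat x i h p q
  rcases hs with hq | ⟨hq, hp⟩
  · have hk := hr.eq i (Nat.lt_succ_of_lt h)
    have hq' : (q : ℕ) < k ⟨i, Nat.lt_succ_of_lt h⟩ := q.2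
    change r i + b ⟨i, Nat.lt_succ_of_lt h⟩ ≤ (q : ℕ) at hq
    obtain ⟨c, rfl⟩ : ∃ c, q = endCol hr i h c :=
      ⟨⟨q - (r i + b ⟨i, Nat.lt_succ_of_lt h⟩), by omega⟩, Fin.ext (by simp [endCol]; omega)⟩
    have h1 : (rowMat hr x i h).submatrix id (endCol hr i h) = pivot hr x i h := by
      ext p c
      exact rowMat_apply_of_le hr x i h p _ (by simp only [endCol]; omega)
    have h2 : imageMat hr x (i + 1) (Nat.succ_lt_succ h) *
        (rowMat hr x i h).submatrix id (endCol hr i h) =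
        (dmat x i h).submatrix id (endCol hr i h) := by
      rw [h1]
      change _ * _⁻¹ * _ = _
      rw [Matrix.mul_assoc, Matrix.nonsing_inv_mul _
        (isUnit_iff_ne_zero.2 (det_pivot_ne_zero hr hx i h)), Matrix.mul_one]
    exact congrFun (congrFun h2 p) c
  · change (p : ℕ) < r (i + 1) at hp
    rw [Matrix.mul_apply, Finset.sum_eq_single ⟨p, hp⟩]
    · rw [imageMat_apply_of_lt hr hx (i + 1) _ p _ hp, if_pos rfl, one_mul,
        rowMat_apply_of_le hr x i h _ _ hq]
      rfl
    · intro c _ hc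
      rw [imageMat_apply_of_lt hr hx (i + 1) _ p _ hp, if_neg, zero_mul]
      exact fun h => hc (Fin.ext h.symm)
    · simp

lemma retraction_mem (hr : IsRankString k b r) {x : Ambient k}
    (hx : eval x (pivotProd hr) ≠ 0) : retraction hr x ∈ bettiComplexes k b := by
  refine (mem_bettiComplexes_iff hr).2 ⟨mem_complexes_iff.2 fun i h => ?_, fun i h => ?_⟩
  · rw [dmat_retraction, dmat_retraction, Matrix.mul_assoc, ← Matrix.mul_assoc (rowMat hr x (i + 1) h),
      rowMat_mul_imageMat hr hx (i + 1) h, Matrix.zero_mul, Matrix.mul_zero]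
  · refine le_antisymm ?_ ?_
    · rw [dmat_retraction]
      exact (Matrix.rank_mul_le_left _ _).trans (Matrix.rank_le_width _)
    have h1 : (dmat (retraction hr x) i h).submatrix (topRow hr i h) (endCol hr i h) =
        pivot hr x i h := by
      ext p c
      exact retraction_apply_of_isFreeCoord hr hx ⟨⟨i, h⟩, (topRow hr i h p, endCol hr i h c)⟩
        (Or.inl (Nat.le_add_right _ _))
    have h2 := Matrix.rank_submatrix_le (dmat (retraction hr x) i h) (topRow hr i h)
      (endCol hr i h)
    rwa [h1, Matrix.rank_of_det_ne_zero (det_pivot_ne_zero hr hx i h), Fintype.card_fin] at h2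

lemma dmat_mul_imageMat (hr : IsRankString k b r) {x : Ambient k} (hx : x ∈ complexes k)
    (i : ℕ) (h : i < n) : dmat x i h * imageMat hr x i (Nat.lt_succ_of_lt h) = 0 := by
  cases i with
  | zero => exact Matrix.mul_zero _
  | succ i =>
    rw [mem_complexes_iff] at hx
    rw [imageMat_succ hr x i (Nat.lt_of_succ_lt h), ← Matrix.mul_assoc]
    have : dmat x (i + 1) h * (dmat x i (Nat.lt_of_succ_lt h)).submatrix id
        (endCol hr i (Nat.lt_of_succ_lt h)) = 0 := by
      ext p c
      exact congrFun (congrFun (hx i h) p) (endCol hr i (Nat.lt_of_succ_lt h) c)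
    rw [this, Matrix.zero_mul]

/-- On the stratum, `rowMat` consists of the actual first rows of `d^i`, and `d^i` is recovered from
them by `Matrix.eq_mul_inv_mul_of_rank_le`. -/
lemma retraction_eq (hr : IsRankString k b r) {x : Ambient k} (hS : x ∈ bettiComplexes k b)
    (hx : eval x (pivotProd hr) ≠ 0) : retraction hr x = x := by
  rw [mem_bettiComplexes_iff hr] at hS
  refine ext_dmat fun i h => ?_
  have hrow : rowMat hr x i h = (dmat x i h).submatrix (topRow hr i h) id := by
    ext p q
    by_cases hq : (q : ℕ) < r i
    · have h0 := congrFun (congrFun (dmat_mul_imageMat hr hS.1 i h) (topRow hr i h p)) ⟨q, hq⟩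
      rw [Matrix.mul_apply, Matrix.zero_apply, ← Finset.sum_filter_add_sum_filter_not _
        (fun s : Fin (k ⟨i, Nat.lt_succ_of_lt h⟩) => r i ≤ (s : ℕ)), add_comm,
        Finset.sum_eq_single q] at h0
      · rw [imageMat_apply_of_lt hr hx _ _ _ _ hq, if_pos rfl, mul_one] at h0
        rw [rowMat, Matrix.of_apply, dif_pos hq]
        exact (eq_neg_of_add_eq_zero_left h0).symm
      · intro s hs hsc
        rw [imageMat_apply_of_lt hr hx _ _ _ _ (not_le.1 (Finset.mem_filter.1 hs).2), if_neg,
          mul_zero]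
        exact fun h => hsc (Fin.ext h)
      · intro hmem
        exact (hmem (by simpa using hq)).elim
    · exact rowMat_apply_of_le hr x i h p q (not_lt.1 hq)
  rw [dmat_retraction, hrow]
  exact (Matrix.eq_mul_inv_mul_of_rank_le _ _ _ (det_pivot_ne_zero hr hx i h) (hS.2 i h).le).symm

lemma dmat_congr {x y : Ambient k} (hxy : ∀ s, IsFreeCoord b r s → x s = y s) (i : ℕ) (h : i < n)
    (p : Fin (k ⟨i + 1, Nat.succ_lt_succ h⟩)) (q : Fin (k ⟨i, Nat.lt_succ_of_lt h⟩))
    (hpq : r i + b ⟨i, Nat.lt_succ_of_lt h⟩ ≤ (q : ℕ) ∨ (r i ≤ (q : ℕ) ∧ (p : ℕ) < r (i + 1))) :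
    dmat x i h p q = dmat y i h p q :=
  hxy ⟨⟨i, h⟩, (p, q)⟩ hpq

lemma pivot_congr (hr : IsRankString k b r) {x y : Ambient k}
    (hxy : ∀ s, IsFreeCoord b r s → x s = y s) (i : ℕ) (h : i < n) :
    pivot hr x i h = pivot hr y i h := by
  ext p c
  exact dmat_congr hxy i h _ _ (Or.inl (Nat.le_add_right _ _))

lemma imageMat_congr (hr : IsRankString k b r) {x y : Ambient k}
    (hxy : ∀ s, IsFreeCoord b r s → x s = y s) (j : ℕ) (hj : j < n + 1) :
    imageMat hr x j hj = imageMat hr y j hj := by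
  cases j with
  | zero => rfl
  | succ i =>
    simp only [imageMat]
    rw [pivot_congr hr hxy]
    congr 1
    ext p c
    exact dmat_congr hxy i _ _ _ (Or.inl (Nat.le_add_right _ _))

lemma retraction_congr (hr : IsRankString k b r) {x y : Ambient k}
    (hxy : ∀ s, IsFreeCoord b r s → x s = y s) : retraction hr x = retraction hr y := by
  refine ext_dmat fun i h => ?_
  rw [dmat_retraction, dmat_retraction, imageMat_congr hr hxy]
  congr 1
  ext p q
  have hp : (topRow hr i h p : ℕ) < r (i + 1) := p.2
  by_cases hq : (q : ℕ) < r i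
  · simp only [rowMat, Matrix.of_apply, hq, dif_pos]
    rw [neg_inj]
    refine Finset.sum_congr rfl fun s hs => ?_
    rw [imageMat_congr hr hxy, dmat_congr hxy i h _ _ (Or.inr ⟨(Finset.mem_filter.1 hs).2, hp⟩)]
  · rw [rowMat_apply_of_le hr x i h p q (not_lt.1 hq),
      rowMat_apply_of_le hr y i h p q (not_lt.1 hq),
      dmat_congr hxy i h _ _ (Or.inr ⟨not_lt.1 hq, hp⟩)]

lemma regularOff_imageMat (hr : IsRankString k b r) (j : ℕ) (hj : j < n + 1)
    (s : Fin (k ⟨j, hj⟩)) (c : Fin (r j)) :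
    RegularOff (pivotProd hr) fun x => imageMat hr x j hj s c := by
  cases j with
  | zero => exact RegularOff.const 0
  | succ i =>
    have h : i < n := Nat.lt_of_succ_lt_succ hj
    simp only [imageMat_succ hr _ i h, Matrix.mul_apply]
    refine RegularOff.sum Finset.univ fun d _ => RegularOff.mul
      (RegularOff.coord (⟨⟨i, h⟩, (s, endCol hr i h d)⟩ : Coord k)) ?_
    simp only [← map_pivotPoly]
    exact RegularOff.inv_apply (det_pivotPoly_dvd hr ⟨i, h⟩) d c

lemma regularOff_retraction (hr : IsRankString k b r) (s : Coord k) :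
    RegularOff (pivotProd hr) fun x => retraction hr x s := by
  obtain ⟨⟨i, h⟩, p, q⟩ := s
  change RegularOff _ fun x => dmat (retraction hr x) i h p q
  simp only [dmat_retraction, Matrix.mul_apply]
  refine RegularOff.sum Finset.univ fun c _ => (regularOff_imageMat hr (i + 1) _ p c).mul ?_
  by_cases hq : (q : ℕ) < r i
  · simp only [rowMat, Matrix.of_apply, hq, dif_pos]
    exact (RegularOff.sum _ fun t _ =>
      (RegularOff.coord (⟨⟨i, h⟩, (topRow hr i h c, t)⟩ : Coord k)).mul
        (regularOff_imageMat hr i _ t ⟨q, hq⟩)).neg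
  · simp only [rowMat_apply_of_le hr _ i h c q (not_lt.1 hq)]
    exact RegularOff.coord (⟨⟨i, h⟩, (topRow hr i h c, q)⟩ : Coord k)

/-- Where all pivot blocks are invertible, the stratum is a graph over the free coordinates. -/
theorem graphChart (hr : IsRankString k b r) :
    GraphChart (bettiComplexes k b) (pivotProd hr) (IsFreeCoord b r) (retraction hr) where
  regular := regularOff_retraction hr
  apply_free _ hx := retraction_apply_of_isFreeCoord hr hx
  congr_map _ _ hxy := retraction_congr hr hxy
  congr_eval x y hxy := by
    rw [eval_pivotProd, eval_pivotProd]
    exact Finset.prod_congr rfl fun i _ => by rw [pivot_congr hr hxy]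
  map_mem _ := retraction_mem hr
  map_eq _ := retraction_eq hr

/-- The pivot blocks of the standard complex are permutation matrices. -/
lemma eval_rankComplex_pivotProd (hr : IsRankString k b r) :
    eval (rankComplex k r) (pivotProd hr) ≠ 0 := by
  rw [eval_pivotProd]
  refine Finset.prod_ne_zero_iff.2 fun i _ => ?_
  have hk := hr.eq i (Nat.lt_succ_of_lt i.2)
  have h : pivot hr (rankComplex k r) i i.2 = (1 : Matrix (Fin (r (i + 1))) (Fin (r (i + 1))) ℂ).submatrix id Fin.revPerm := by
    ext p c
    have hp := p.2
    have hc := c.2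
    change (if (topRow hr i i.2 p : ℕ) + endCol hr i i.2 c + 1 = k ⟨i, _⟩ then
      (if (topRow hr i i.2 p : ℕ) < r (i + 1) then (1 : ℂ) else 0) else 0) = _
    rw [Matrix.submatrix_apply, Matrix.one_apply]
    simp only [topRow, endCol, Fin.ext_iff, hp, if_true, id, Fin.revPerm_apply, Fin.val_rev]
    refine if_congr ?_ rfl rfl
    omega
  rw [h, Matrix.det_permute', Matrix.det_one, mul_one]
  simp

/-- The symmetry group acts transitively, so that every point can be moved into the chart. -/
lemma exists_linearEquiv_eval_pivotProd (hr : IsRankString k b r) {x : Ambient k}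
    (hx : x ∈ bettiComplexes k b) :
    ∃ L : Ambient k ≃ₗ[ℂ] Ambient k, (∀ y, L y ∈ bettiComplexes k b ↔ y ∈ bettiComplexes k b) ∧
      eval (L x) (pivotProd hr) ≠ 0 := by
  obtain ⟨g, g', h, rfl⟩ := exists_conj_rankComplex hr hx
  have h' : ∀ j, g' j * g j = 1 := fun j => mul_eq_one_comm.1 (h j)
  refine ⟨conjEquiv g' g h', conjEquiv_mem_iff h', ?_⟩
  change eval (conj g' g (conj g g' (rankComplex k r))) _ ≠ 0
  rw [conj_conj h']
  exact eval_rankComplex_pivotProd hr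

/-! ### The number of free coordinates -/

lemma card_isFreeCoord (hr : IsRankString k b r) :
    Nat.card {s : Coord k // IsFreeCoord b r s} =
      ∑ i : Fin n, r (i + 1) * (k i.succ + b i.castSucc) := by
  have hbound : ∀ i : Fin n, k i.castSucc = r i + b i.castSucc + r (i + 1) ∧
      k i.succ = r (i + 1) + b i.succ + r (i + 1 + 1) :=
    fun i => ⟨hr.eq i _, hr.eq (i + 1) _⟩
  -- the two alternatives in `IsFreeCoord`, made disjoint
  let T : Fin n → Type := fun i =>
    (Fin (k i.succ) × Fin (r (i + 1))) ⊕ (Fin (r (i + 1)) × Fin (b i.castSucc))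
  let F : (Σ i, T i) → {s : Coord k // IsFreeCoord b r s} := fun t => match t with
    | ⟨i, Sum.inl (p, c)⟩ => ⟨⟨i, (p, ⟨r i + b i.castSucc + c, by
        have := hbound i; have := c.2; omega⟩)⟩, Or.inl (Nat.le_add_right _ _)⟩
    | ⟨i, Sum.inr (p, c)⟩ => ⟨⟨i, (⟨p, by have := hbound i; have := p.2; omega⟩, ⟨r i + c, by
        have := hbound i; have := c.2; omega⟩)⟩, Or.inr ⟨Nat.le_add_right _ _, p.2⟩⟩
  have hF : Function.Bijective F := by
    constructor
    · rintro ⟨i, ⟨p, c⟩ | ⟨p, c⟩⟩ ⟨i', ⟨p', c'⟩ | ⟨p', c'⟩⟩ h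
      all_goals
        have h1 := congrArg Subtype.val h
        simp only [F, Sigma.mk.injEq] at h1
        obtain ⟨rfl, h1⟩ := h1
        have h2 := c.2
        have h3 := c'.2
        simp [Fin.ext_iff] at h1
      · obtain ⟨h1, h4⟩ := h1
        rw [Fin.ext h1, Fin.ext h4]
      · omega
      · omega
      · obtain ⟨h1, h4⟩ := h1
        rw [Fin.ext h1, Fin.ext h4]
    · rintro ⟨⟨i, p, q⟩, h⟩
      have hq := q.2
      have hb := hbound i
      by_cases h1 : r i + b i.castSucc ≤ q
      · refine ⟨⟨i, Sum.inl (p, ⟨q - (r i + b i.castSucc), by omega⟩)⟩, ?_⟩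
        refine Subtype.ext ?_
        simp only [F, Sigma.mk.injEq, heq_eq_eq, true_and, Prod.mk.injEq, Fin.ext_iff]
        omega
      · obtain ⟨h2, h3⟩ := h.resolve_left h1
        simp only at h2 h3
        refine ⟨⟨i, Sum.inr (⟨p, h3⟩, ⟨q - r i, by omega⟩)⟩, ?_⟩
        refine Subtype.ext ?_
        simp only [F, Sigma.mk.injEq, heq_eq_eq, true_and, Prod.mk.injEq, Fin.ext_iff]
        omega
  rw [← Nat.card_congr (Equiv.ofBijective F hF), Nat.card_sigma]
  refine Finset.sum_congr rfl fun i _ => ?_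
  simp only [T, Nat.card_sum, Nat.card_prod, Nat.card_fin]
  ring

/-- Substituting `k_j = r_j + b_j + r_{j+1}`, the dimension formula becomes the number of free
coordinates up to shifts of the summation index, where the boundary terms vanish because
`r_0 = r_{n+1} = 0`. -/
lemma card_isFreeCoord_eq_dimFormula (hr : IsRankString k b r) :
    (Nat.card {s : Coord k // IsFreeCoord b r s} : ℤ) = dimFormula k b := by
  have hk : ∀ j : Fin (n + 1), (k j : ℤ) = r j + b j + r (j + 1) := fun j => by
    exact_mod_cast hr.eq j j.2
  have h : dimFormula k b = ∑ j : Fin (n + 1), ((r j : ℤ) * (r j + b j + r (j + 1)) +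
      r (j + 1) * b j) := by
    refine Finset.sum_congr rfl fun j _ => ?_
    rw [hr.altSum_eq, hk]
    ring
  rw [h, Finset.sum_add_distrib, Fin.sum_univ_succ, Fin.sum_univ_castSucc (n := n), card_isFreeCoord hr]
  push_cast
  simp only [Fin.val_zero, hr.zero, hr.last, Fin.val_succ, Fin.val_castSucc]
  rw [Nat.cast_zero, zero_mul, zero_mul, zero_add, add_zero, ← Finset.sum_add_distrib]
  refine Finset.sum_congr rfl fun i _ => ?_
  rw [hk i.succ, Fin.val_succ]
  ring

end CochainStrings

/-! ### Connectedness and irreducibility of the strata -/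

/-- Regular functions are continuous for the Euclidean topology. -/
lemma RegularOff.continuousOn_euclidean {σ : Type} {f : MvPolynomial σ ℂ} {g : (σ → ℂ) → ℂ}
    (hg : RegularOff f g) : ContinuousOn g {x | eval x f ≠ 0} := by
  obtain ⟨P, m, hP⟩ := hg
  have h : ContinuousOn (fun x => eval x P / eval x f ^ m) {x | eval x f ≠ 0} :=
    P.continuous_eval.continuousOn.div (f.continuous_eval.pow m).continuousOn
      fun x hx => pow_ne_zero _ hx
  refine h.congr fun x hx => ?_
  change g x = eval x P / eval x f ^ m
  rw [← hP x hx, mul_div_cancel_left₀ _ (pow_ne_zero _ hx)]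

/-- A principal open set of affine space is connected: a complex line that meets it does so in the
complement of a finite set. -/
lemma isConnected_setOf_eval_ne_zero {σ : Type} {f : MvPolynomial σ ℂ} {x₀ : σ → ℂ}
    (h₀ : eval x₀ f ≠ 0) : IsConnected {x : σ → ℂ | eval x f ≠ 0} := by
  refine ⟨⟨x₀, h₀⟩, isPreconnected_of_forall_pair fun x hx y hy => ?_⟩
  let γ : ℂ → σ → ℂ := fun t s => x s + t * (y s - x s)
  have hpoly : ∀ p : MvPolynomial σ ℂ, ∃ q : Polynomial ℂ, ∀ t, q.eval t = eval (γ t) p := by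
    intro p
    induction p using MvPolynomial.induction_on with
    | C a => exact ⟨Polynomial.C a, by simp⟩
    | add p p' hp hp' =>
      obtain ⟨q, hq⟩ := hp
      obtain ⟨q', hq'⟩ := hp'
      exact ⟨q + q', by simp [hq, hq']⟩
    | mul_X p s hp =>
      obtain ⟨q, hq⟩ := hp
      exact ⟨q * (Polynomial.C (x s) + Polynomial.X * Polynomial.C (y s - x s)),
        by simp [hq, γ]⟩
  obtain ⟨q, hq⟩ := hpoly f
  have h0 : γ 0 = x := by simp [γ]
  have h1 : γ 1 = y := by simp [γ]
  have hq0 : q ≠ 0 := by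
    rintro rfl
    have := hq 0
    rw [h0, Polynomial.eval_zero] at this
    exact hx this.symm
  have hroot : ∀ t, t ∈ ((q.roots.toFinset : Set ℂ)ᶜ) ↔ eval (γ t) f ≠ 0 := fun t => by
    simp [hq0, ← hq]
  have hconn : IsConnected ((q.roots.toFinset : Set ℂ)ᶜ) :=
    Set.Countable.isConnected_compl_of_one_lt_rank (by simp)
      q.roots.toFinset.countable_toSet
  have hγ : Continuous γ := by fun_prop
  refine ⟨γ '' (q.roots.toFinset : Set ℂ)ᶜ, ?_, ⟨0, ?_, h0⟩, ⟨1, ?_, h1⟩,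
    hconn.isPreconnected.image _ hγ.continuousOn⟩
  · rintro _ ⟨t, ht, rfl⟩
    exact (hroot t).1 ht
  · exact (hroot 0).2 (by rwa [h0])
  · exact (hroot 1).2 (by rwa [h1])

namespace CochainStrings

variable {n : ℕ} {k b : Fin (n + 1) → ℕ} {r : ℕ → ℕ}

/-- The matrices of coordinates on `∏_j M_{k_j}(ℂ)`. -/
noncomputable def frame (k : Fin (n + 1) → ℕ) (j : Fin (n + 1)) :
    Matrix (Fin (k j)) (Fin (k j))
      (MvPolynomial (Σ j : Fin (n + 1), Fin (k j) × Fin (k j)) ℂ) :=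
  Matrix.of fun p q => X ⟨j, (p, q)⟩

/-- The polynomial whose non-vanishing defines `∏_j GL_{k_j}(ℂ)`. -/
noncomputable def frameDet (k : Fin (n + 1) → ℕ) :
    MvPolynomial (Σ j : Fin (n + 1), Fin (k j) × Fin (k j)) ℂ :=
  ∏ j, (frame k j).det

lemma eval_frame (g : ∀ j, Matrix (Fin (k j)) (Fin (k j)) ℂ) (j : Fin (n + 1)) :
    (eval fun s : Σ j : Fin (n + 1), Fin (k j) × Fin (k j) => g s.1 s.2.1 s.2.2).mapMatrix
      (frame k j) = g j := by
  ext p q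
  simp [frame]

/-- The orbit map `g ↦ (g_{i+1} d^i g_i⁻¹)_i` of the standard complex. -/
noncomputable def orbitMap (k : Fin (n + 1) → ℕ) (r : ℕ → ℕ)
    (y : (Σ j : Fin (n + 1), Fin (k j) × Fin (k j)) → ℂ) : Ambient k :=
  conj (fun j => (eval y).mapMatrix (frame k j)) (fun j => ((eval y).mapMatrix (frame k j))⁻¹)
    (rankComplex k r)

lemma regularOff_orbitMap (k : Fin (n + 1) → ℕ) (r : ℕ → ℕ) (s : Coord k) :
    RegularOff (frameDet k) fun y => orbitMap k r y s := by
  obtain ⟨⟨i, h⟩, p, q⟩ := s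
  change RegularOff _ fun y => dmat (orbitMap k r y) i h p q
  simp only [orbitMap, dmat_conj, Matrix.mul_apply]
  refine RegularOff.sum _ fun c _ => RegularOff.mul (RegularOff.sum _ fun d _ =>
    (RegularOff.polynomial (frame k ⟨i + 1, Nat.succ_lt_succ h⟩ p d)).mul (RegularOff.const _)) ?_
  refine RegularOff.inv_apply ?_ c q
  rw [frameDet]
  exact Finset.dvd_prod_of_mem (fun j => (frame k j).det) (Finset.mem_univ _)

lemma image_orbitMap (hr : IsRankString k b r) :
    orbitMap k r '' {y | eval y (frameDet k) ≠ 0} = bettiComplexes k b := by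
  ext x
  constructor
  · rintro ⟨y, hy, rfl⟩
    refine conj_mem (fun j => Matrix.mul_nonsing_inv _ (isUnit_iff_ne_zero.2 ?_))
      (rankComplex_mem hr)
    rw [← RingHom.map_det]
    change eval y (frameDet k) ≠ 0 at hy
    rw [frameDet, map_prod] at hy
    exact Finset.prod_ne_zero_iff.1 hy j (Finset.mem_univ j)
  · intro hx
    obtain ⟨g, g', h, rfl⟩ := exists_conj_rankComplex hr hx
    refine ⟨fun s => g s.1 s.2.1 s.2.2, ?_, ?_⟩
    · change eval _ (frameDet k) ≠ 0
      rw [frameDet, map_prod]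
      refine Finset.prod_ne_zero_iff.2 fun j _ => ?_
      rw [RingHom.map_det, eval_frame]
      exact Matrix.det_ne_zero_of_right_inverse (h j)
    · rw [orbitMap]
      simp only [eval_frame]
      congr 1
      rw [show (fun j => (g j)⁻¹) = g' from funext fun j => Matrix.inv_eq_right_inv (h j)]

lemma eval_one_frameDet (k : Fin (n + 1) → ℕ) :
    eval (fun s : Σ j : Fin (n + 1), Fin (k j) × Fin (k j) =>
      (1 : Matrix (Fin (k s.1)) (Fin (k s.1)) ℂ) s.2.1 s.2.2) (frameDet k) ≠ 0 := by
  rw [frameDet, map_prod]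
  refine Finset.prod_ne_zero_iff.2 fun j _ => ?_
  rw [RingHom.map_det, eval_frame fun j => 1, Matrix.det_one]
  exact one_ne_zero

lemma isIrreducible_bettiComplexes (hr : IsRankString k b r) :
    IsIrreducible (X := ZSpace (Coord k)) (bettiComplexes k b) := by
  rw [← image_orbitMap hr]
  refine IsIrreducible.image (X := ZSpace _) (Y := ZSpace (Coord k)) ⟨⟨_, eval_one_frameDet k⟩, ?_⟩ _
    (RegularOff.continuousOn (regularOff_orbitMap k r))
  exact (PreirreducibleSpace.isPreirreducible_univ (X := ZSpace _)).open_subset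
    (ZSpace.isOpen_ne _) (Set.subset_univ _)

lemma isConnected_bettiComplexes (hr : IsRankString k b r) :
    IsConnected (bettiComplexes k b) := by
  rw [← image_orbitMap hr]
  exact (isConnected_setOf_eval_ne_zero (eval_one_frameDet k)).image _
    (continuousOn_pi.2 fun s => (regularOff_orbitMap k r s).continuousOn_euclidean)

/-! ### Rank conditions in the Zariski topology -/

lemma isClosed_complexes (k : Fin (n + 1) → ℕ) :
    IsClosed (X := ZSpace (Coord k)) (complexes k) := by
  have h : (complexes k : Set (Coord k → ℂ)) = ⋂ (i : ℕ) (h : i + 1 < n)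
      (p : Fin (k ⟨i + 1 + 1, Nat.succ_lt_succ h⟩)) (q : Fin (k ⟨i, Nat.lt_of_succ_lt
        (Nat.lt_succ_of_lt h)⟩)), {x | eval x (∑ s : Fin (k ⟨i + 1, Nat.lt_succ_of_lt h⟩),
          X (⟨⟨i + 1, h⟩, (p, s)⟩ : Coord k) *
            X (⟨⟨i, Nat.lt_of_succ_lt h⟩, (s, q)⟩ : Coord k)) = 0} := by
    ext x
    simp only [mem_complexes_iff, Set.mem_iInter]
    refine forall₂_congr fun i h => ?_
    rw [← Matrix.ext_iff]
    refine forall₂_congr fun p q => ?_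
    rw [Matrix.mul_apply, Set.mem_ofPred_eq, map_sum, Matrix.zero_apply]
    simp only [map_mul, eval_X]
    rfl
  refine h ▸ ?_
  exact isClosed_iInter fun i => isClosed_iInter fun h => isClosed_iInter fun p =>
    isClosed_iInter fun q => ZSpace.isClosed_zeros _

/-- Lower bounds on ranks are open: if `d^i` has rank at least `s` at some point, then
`P d^i Q = 1` there for suitable constant matrices `P` and `Q`, and `det (P d^i Q)` is a
polynomial. -/
lemma isOpen_le_rank (i : ℕ) (h : i < n) (s : ℕ) :
    IsOpen (X := ZSpace (Coord k)) {x | s ≤ (dmat x i h).rank} := by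
  refine (isOpen_iff_forall_mem_open (X := ZSpace (Coord k))).2 fun x₀ hx₀ => ?_
  obtain ⟨w, hw⟩ := (dmat x₀ i h).exists_linearIndependent_mulVec hx₀
  let Q : Matrix (Fin (k ⟨i, Nat.lt_succ_of_lt h⟩)) (Fin s) ℂ := Matrix.of fun a p => w p a
  have hinj : Function.Injective (dmat x₀ i h * Q).mulVecLin :=
    Matrix.mulVec_injective_iff.2 hw
  obtain ⟨P', hP'⟩ := LinearMap.exists_leftInverse_of_injective _ (LinearMap.ker_eq_bot.2 hinj)
  let P := LinearMap.toMatrix' P'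
  have hP : P * (dmat x₀ i h * Q) = 1 := by
    rw [← LinearMap.toMatrix'_id, ← hP', LinearMap.toMatrix'_comp, ← Matrix.toLin'_apply',
      LinearMap.toMatrix'_toLin']
  let Λ : Ambient k →ₗ[ℂ] (Fin s × Fin s → ℂ) :=
    { toFun := fun x pq => (P * (dmat x i h * Q)) pq.1 pq.2
      map_add' := fun x y => by
        have : dmat (x + y) i h = dmat x i h + dmat y i h := rfl
        funext pq
        simp only [this, Matrix.add_mul, Matrix.mul_add, Pi.add_apply, Matrix.add_apply]
      map_smul' := fun c x => by
        have : dmat (c • x) i h = c • dmat x i h := rfl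
        funext pq
        simp only [this, Matrix.smul_mul, Matrix.mul_smul, Pi.smul_apply, Matrix.smul_apply,
          RingHom.id_apply] }
  obtain ⟨g, hg⟩ := exists_eval_eq_eval_linearMap Λ (Matrix.mvPolynomialX (Fin s) (Fin s) ℂ).det
  have hdet : ∀ x, eval x g = (P * (dmat x i h * Q)).det := fun x => by
    rw [hg, RingHom.map_det]
    congr 1
    exact Matrix.mvPolynomialX_mapMatrix_eval (P * (dmat x i h * Q))
  refine ⟨{x | eval x g ≠ 0}, fun x hx => ?_, ZSpace.isOpen_ne g, ?_⟩
  · have hx' : (P * (dmat x i h * Q)).det ≠ 0 := fun h0 => hx ((hdet x).trans h0)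
    have := Matrix.rank_of_det_ne_zero hx'
    rw [Fintype.card_fin] at this
    exact this.ge.trans ((Matrix.rank_mul_le_right _ _).trans (Matrix.rank_mul_le_left _ _))
  · have h1 := hdet x₀
    rw [hP, Matrix.det_one] at h1
    exact fun h0 => one_ne_zero (h1.symm.trans h0)

lemma isClosed_rank_le (i : ℕ) (h : i < n) (s : ℕ) :
    IsClosed (X := ZSpace (Coord k)) {x | (dmat x i h).rank ≤ s} := by
  have h1 := (isOpen_le_rank (k := k) i h (s + 1)).isClosed_compl
  have h2 : {x : Ambient k | s + 1 ≤ (dmat x i h).rank}ᶜ = {x | (dmat x i h).rank ≤ s} := by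
    ext x
    simp
  exact h2 ▸ h1

/-- The complexes whose differentials have ranks bounded by `r`. -/
def boundedRankComplexes (k : Fin (n + 1) → ℕ) (r : ℕ → ℕ) : Set (Ambient k) :=
  complexes k ∩ ⋂ i : Fin n, {x | (dmat x i i.2).rank ≤ r (i + 1)}

lemma mem_boundedRankComplexes {x : Ambient k} : x ∈ boundedRankComplexes k r ↔
    x ∈ complexes k ∧ ∀ i (h : i < n), (dmat x i h).rank ≤ r (i + 1) := by
  rw [boundedRankComplexes, Set.mem_inter_iff, Set.mem_iInter]
  exact and_congr_right fun _ => ⟨fun h i hi => h ⟨i, hi⟩, fun h i => h i i.2⟩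

lemma isClosed_boundedRankComplexes (k : Fin (n + 1) → ℕ) (r : ℕ → ℕ) :
    IsClosed (X := ZSpace (Coord k)) (boundedRankComplexes k r) :=
  IsClosed.inter (isClosed_complexes k) (isClosed_iInter fun i => isClosed_rank_le i i.2 _)

lemma isQuasiAffine_bettiComplexes (hr : IsRankString k b r) :
    IsQuasiAffine (bettiComplexes k b) := by
  have h1 : IsOpen (X := ZSpace (Coord k))
      (⋂ i : Fin n, {x | r (i + 1) ≤ (dmat x i i.2).rank}) :=
    isOpen_iInter_of_finite fun i => isOpen_le_rank i i.2 _
  have h2 : bettiComplexes k b =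
      (⋂ i : Fin n, {x | r (i + 1) ≤ (dmat x i i.2).rank}) ∩ boundedRankComplexes k r := by
    ext x
    rw [mem_bettiComplexes_iff hr, Set.mem_inter_iff, mem_boundedRankComplexes, Set.mem_iInter]
    constructor
    · exact fun h => ⟨fun i => (h.2 i i.2).ge, h.1, fun i hi => (h.2 i hi).le⟩
    · exact fun h => ⟨h.2.1, fun i hi => le_antisymm (h.2.2 i hi) (h.1 ⟨i, hi⟩)⟩
  refine h2 ▸ ?_
  exact h1.isLocallyClosed.inter (isClosed_boundedRankComplexes k r).isLocallyClosed

/-! ### The closure of a stratum -/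

lemma bettiComplexes_subset_boundedRankComplexes (hr : IsRankString k b r) :
    bettiComplexes k b ⊆ boundedRankComplexes k r := fun x hx => by
  rw [mem_bettiComplexes_iff hr] at hx
  exact mem_boundedRankComplexes.2 ⟨hx.1, fun i hi => (hx.2 i hi).le⟩

/-- Every complex with ranks at most `r` is a limit of complexes with ranks equal to `r`: bring it
to normal form and turn on the missing entries of the standard complex of ranks `r` with a small
weight. -/
lemma boundedRankComplexes_subset_closure (hr : IsRankString k b r) :
    boundedRankComplexes k r ⊆ closure (bettiComplexes k b) := by
  intro x hx
  rw [mem_boundedRankComplexes] at hx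
  have hr' := isRankString_ranks hx.1
  obtain ⟨g, g', h, hxg⟩ := exists_conj_rankComplex hr'
    (show x ∈ bettiComplexes k _ from ⟨hx.1, fun _ => rfl⟩)
  -- weights joining `rankComplex k (ranks x)`, at `t = 0`, to complexes of ranks `r`
  let w : ℂ → ℕ → ℕ → ℂ := fun t i p =>
    if p < ranks x (i + 1) then 1 else if p < r (i + 1) then t else 0
  have hle : ∀ i, ranks x (i + 1) ≤ r (i + 1) := fun i => by
    by_cases hi : i < n
    · rw [ranks_succ x hi]
      exact hx.2 i hi
    · simp [ranks, hi]
  have hmem : ∀ t : ℂ, t ≠ 0 → conj g g' (standardComplex k (w t)) ∈ bettiComplexes k b := by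
    intro t ht
    refine conj_mem h (standardComplex_mem_bettiComplexes hr fun i p => ?_)
    have := hle i
    simp only [w]
    split_ifs with h1 h2
    · simp; omega
    · simp [ht, h2]
    · simp [h2]
  have hcont : Continuous fun t : ℂ => conj g g' (standardComplex k (w t)) := by
    refine (LinearMap.continuous_of_finiteDimensional (conj g g')).comp ?_
    refine continuous_pi fun s => ?_
    obtain ⟨⟨i, hi⟩, p, q⟩ := s
    change Continuous fun t : ℂ => dmat (standardComplex k (w t)) i hi p q
    simp only [dmat_standardComplex, w]
    split_ifs <;> fun_prop
  have h0 : conj g g' (standardComplex k (w 0)) = x := by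
    rw [hxg, rankComplex]
    congr 3
    funext i p
    simp [w]
  have hlim : Tendsto (fun t : ℂ => conj g g' (standardComplex k (w t))) (𝓝[≠] 0) (𝓝 x) := by
    have := hcont.tendsto 0
    rw [h0] at this
    exact this.mono_left nhdsWithin_le_nhds
  refine mem_closure_of_tendsto hlim ?_
  filter_upwards [self_mem_nhdsWithin] with t ht using hmem t ht

lemma closure_subset_zariskiClosure {σ : Type} (S : Set (σ → ℂ)) :
    closure S ⊆ zariskiClosure S :=
  closure_minimal (subset_closure (X := ZSpace σ))
    (ZSpace.isClosed_euclidean (isClosed_closure (X := ZSpace σ)))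

lemma zariskiClosure_bettiComplexes (hr : IsRankString k b r) :
    zariskiClosure (bettiComplexes k b) = boundedRankComplexes k r :=
  Set.Subset.antisymm
    (closure_minimal (X := ZSpace (Coord k)) (bettiComplexes_subset_boundedRankComplexes hr)
      (isClosed_boundedRankComplexes k r))
    ((boundedRankComplexes_subset_closure hr).trans (closure_subset_zariskiClosure _))

lemma closure_bettiComplexes (hr : IsRankString k b r) :
    closure (bettiComplexes k b) = zariskiClosure (bettiComplexes k b) :=
  Set.Subset.antisymm (closure_subset_zariskiClosure _)
    ((zariskiClosure_bettiComplexes hr).le.trans (boundedRankComplexes_subset_closure hr))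

lemma boundedRankComplexes_eq_iUnion (hr : IsRankString k b r) :
    boundedRankComplexes k r =
      ⋃ b' ∈ {b' : Fin (n + 1) → ℕ | Dominates k b' ∧ Dominates b' b}, bettiComplexes k b' := by
  ext x
  rw [mem_boundedRankComplexes]
  simp only [Set.mem_iUnion, exists_prop]
  constructor
  · rintro ⟨hx, hrk⟩
    have hr' := isRankString_ranks hx
    refine ⟨_, ⟨hr'.dominates, (hr.dominates_iff hr').2 fun i hi => ?_⟩, hx, fun _ => rfl⟩
    rw [ranks_succ x hi]
    exact hrk i hi
  · rintro ⟨b', ⟨h1, h2⟩, hx⟩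
    obtain ⟨r', hr'⟩ := h1.exists_isRankString
    rw [mem_bettiComplexes_iff hr'] at hx
    exact ⟨hx.1, fun i hi => (hx.2 i hi).le.trans ((hr.dominates_iff hr').1 h2 i hi)⟩

lemma bettiComplexes_eq_empty (h : ¬ Dominates k b) : bettiComplexes k b = ∅ :=
  Set.eq_empty_of_forall_notMem fun _ hx => h (dominates_of_mem_bettiComplexes hx)

/-- The geometric properties of a non-empty stratum. -/
theorem geometry_bettiComplexes (h : Dominates k b) :
    IsSmoothQuasiAffine (bettiComplexes k b) ∧ IsZariskiConnected (bettiComplexes k b) ∧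
      IsConnected (bettiComplexes k b) ∧
      (∃ m : ℕ, zariskiDim (bettiComplexes k b) = (m : WithBot ℕ∞) ∧ (m : ℤ) = dimFormula k b) ∧
      IsAffineVariety (zariskiClosure (bettiComplexes k b)) := by
  obtain ⟨r, hr⟩ := h.exists_isRankString
  have hL := fun x hx => exists_linearEquiv_eval_pivotProd hr (x := x) hx
  exact ⟨⟨isQuasiAffine_bettiComplexes hr, fun x hx => (graphChart hr).isSmooth hL hx⟩,
    (isIrreducible_bettiComplexes hr).isConnected, isConnected_bettiComplexes hr,
    ⟨_, (graphChart hr).zariskiDim_eq hL ⟨_, rankComplex_mem hr⟩,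
      card_isFreeCoord_eq_dimFormula hr⟩,
    isClosed_closure (X := ZSpace (Coord k)), (isIrreducible_bettiComplexes hr).closure⟩

end CochainStrings

theorem proposition2 {n : ℕ} (k : Fin (n + 1) → ℕ) :
    -- acyclic complexes, for admissible `k`
    (Admissible (fun i => (k i : ℤ)) →
      IsSmoothQuasiAffine (CochainStrings.acyclicComplexes k) ∧
      IsZariskiConnected (CochainStrings.acyclicComplexes k) ∧
      IsConnected (CochainStrings.acyclicComplexes k) ∧
      (∃ m : ℕ, zariskiDim (CochainStrings.acyclicComplexes k) = (m : WithBot ℕ∞) ∧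
        (m : ℤ) = CochainStrings.dimFormula k 0) ∧
      IsAffineVariety (zariskiClosure (CochainStrings.acyclicComplexes k))) ∧
    -- complexes with prescribed Betti numbers `b`, for `k ≥ b`
    (∀ b : Fin (n + 1) → ℕ, Dominates k b →
      IsSmoothQuasiAffine (CochainStrings.bettiComplexes k b) ∧
      IsZariskiConnected (CochainStrings.bettiComplexes k b) ∧
      IsConnected (CochainStrings.bettiComplexes k b) ∧
      (∃ m : ℕ, zariskiDim (CochainStrings.bettiComplexes k b) = (m : WithBot ℕ∞) ∧
        (m : ℤ) = CochainStrings.dimFormula k b) ∧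
      IsAffineVariety (zariskiClosure (CochainStrings.bettiComplexes k b))) ∧
    -- the strata of the closure; the Zariski and the Euclidean closure coincide
    (∀ b : Fin (n + 1) → ℕ,
      zariskiClosure (CochainStrings.bettiComplexes k b) =
        ⋃ b' ∈ {b' : Fin (n + 1) → ℕ | Dominates k b' ∧ Dominates b' b},
          CochainStrings.bettiComplexes k b' ∧
      closure (CochainStrings.bettiComplexes k b) =
        zariskiClosure (CochainStrings.bettiComplexes k b) ∧
      {b' : Fin (n + 1) → ℕ | Dominates k b' ∧ Dominates b' b}.PairwiseDisjoint
        (CochainStrings.bettiComplexes k)) := by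

  refine ⟨fun h => ?_, fun b h => CochainStrings.geometry_bettiComplexes h, fun b => ?_⟩
  · rw [CochainStrings.acyclicComplexes_eq]
    exact CochainStrings.geometry_bettiComplexes (by simpa [Dominates] using h)
  · have hdisj : {b' : Fin (n + 1) → ℕ | Dominates k b' ∧ Dominates b' b}.PairwiseDisjoint
        (CochainStrings.bettiComplexes k) := fun b₁ _ b₂ _ hne =>
      Set.disjoint_left.2 fun x hx₁ hx₂ => hne (funext fun i => (hx₁.2 i).symm.trans (hx₂.2 i))
    by_cases h : Dominates k b
    · obtain ⟨r, hr⟩ := h.exists_isRankString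
      exact ⟨(CochainStrings.zariskiClosure_bettiComplexes hr).trans
        (CochainStrings.boundedRankComplexes_eq_iUnion hr),
        CochainStrings.closure_bettiComplexes hr, hdisj⟩
    · have hz : zariskiClosure (CochainStrings.bettiComplexes k b) = ∅ := by
        rw [CochainStrings.bettiComplexes_eq_empty h]
        exact closure_empty (X := ZSpace _)
      refine ⟨?_, ?_, hdisj⟩
      · rw [hz, eq_comm]
        simp only [Set.iUnion_eq_empty]
        exact fun b' hb' => absurd (hb'.1.trans hb'.2) h
      · rw [hz, CochainStrings.bettiComplexes_eq_empty h, closure_empty]
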